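/- Let $0<\beta<1$ and $a,t_0\in\mathbb R$ with $a\le t_0$. For $\alpha>0$ and $f:(a,\infty)\to\mathbb R$ continuous and integrable on every $(a,t)$, $t>a$, put $$(I_a^{\alpha}f)(t)=\frac1{\Gamma(\alpha)}\int_a^t(t-\tau)^{\alpha-1}f(\tau)\,d\tau ,\qquad D_a^{\beta}f=\frac{d}{dt}\,I_a^{1-\beta}f ,\qquad t>a ,$$ $\mathscr D_a^{\beta}u=D_a^{\beta}u$ and $\mathscr D_a^{2\beta}u=D_a^{\beta}D_a^{\beta}u$ (Riemann–Liouville and sequential derivatives), and let $E_{\beta,\beta}(z)=\sum_{k\ge0}z^k/\Gamma(k\beta+\beta)$. Let $a_0,a_1\in\mathbb R$ be such that the roots $r_1,r_2$ of $r^2+a_1r+a_0=0$ are distinct negative real numbers. Let $u:(a,\infty)\to\mathbb R$ be such that $u$ and $D_a^\beta u$ are continuous on $(a,\infty)$ and integrable on every $(a,t)$, that $I_a^{1-\beta}u$ and $I_a^{1-\beta}D_a^\beta u$ are differentiable on $(a,\infty)$, and that $$\mathscr D_a^{2\beta}u+a_1\mathscr D_a^{\beta}u+a_0u=0\quad\text{on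 }(a,\infty).$$ Suppose that $u$ has initial data $u_0,u_1\in\mathbb R$ at $t_0$ in one of the following two senses, and that the data are non-degenerate: 1. $t_0>a$, $u(t_0)=u_0$, $\mathscr D_a^{\beta}u(t_0)=u_1$, and $$r_1^2\,(u_1-r_1u_0)\,E_{\beta,\beta}\big(r_1(t_0-a)^\beta\big)\ne r_2^2\,(u_1-r_2u_0)\,E_{\beta,\beta}\big(r_2(t_0-a)^\beta\big);$$ 2. $t_0=a$, $\lim_{t\to t_0^+}(I_{t_0}^{1-\beta}u)(t)=u_0$, $\lim_{t\to t_0^+}(I_{t_0}^{1-\beta}\mathscr D_{t_0}^{\beta}u)(t)=u_1$, and $a_1u_1+(a_1^2-a_0)u_0\ne0$. Then $u$ is differentiable on $(a,\infty)$, $u(t)\neq0$ for all sufficiently large $t$, the limit $\lim_{t\to\infty}t\,u'(t)/u(t)$ exists and is finite, and $$\beta=-1-\lim_{t\to\infty}\frac{t\,u'(t)}{u(t)} .$$ -/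

import Mathlib

open Filter Topology

noncomputable section

/-- Riemann-Liouville fractional integral of order `α` with lower terminal `a`:
`(1 / Γ(α)) ∫_a^t (t - τ)^(α - 1) f(τ) dτ`, used for `t > a`. -/
def rlIntegral (a α : ℝ) (f : ℝ → ℝ) (t : ℝ) : ℝ :=
  (1 / Real.Gamma α) * ∫ τ in a..t, (t - τ) ^ (α - 1) * f τ

/-- The number of classical derivatives, `n = [α] + 1`, in the Riemann-Liouville derivative of
order `α`. -/
def rlOrder (α : ℝ) : ℕ := ⌊α⌋₊ + 1

/-- Riemann-Liouville fractional derivative of order `α` with lower terminal `a`: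
`(d/dt)^n I_a^(n - α) f` with `n = [α] + 1`, used for `t > a`. -/
def rlDeriv (a α : ℝ) (f : ℝ → ℝ) : ℝ → ℝ :=
  iteratedDeriv (rlOrder α) (rlIntegral a ((rlOrder α : ℝ) - α) f)

/-- `f` has a Riemann-Liouville derivative of order `α` on `(a, ∞)`: it is continuous on `(a, ∞)`,
integrable on every `(a, t)`, and `I_a^(n - α) f` is `n` times differentiable at every `t > a`. -/
structure RLDifferentiable (a α : ℝ) (f : ℝ → ℝ) : Prop where
  continuousOn : ContinuousOn f (Set.Ioi a)
  integrableOn : ∀ t, a < t → MeasureTheory.IntegrableOn f (Set.Ioo a t)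
  differentiableAt : ∀ t, a < t → ∀ k < rlOrder α,
    DifferentiableAt ℝ (iteratedDeriv k (rlIntegral a ((rlOrder α : ℝ) - α) f)) t

/-- Sequential derivative `𝒟^(nα) = D^α D^α ⋯ D^α` (`n` factors). -/
def seqRLDeriv (a α : ℝ) (n : ℕ) (f : ℝ → ℝ) : ℝ → ℝ := (rlDeriv a α)^[n] f

/-- `u` solves `𝒟^(2β) u + a₁ 𝒟^β u + a₀ u = 0` on `(a, ∞)`, both sequential derivatives being
Riemann-Liouville derivatives with lower terminal `a` that exist in the sense above. -/
structure IsSeqRLSolution (a β a₁ a₀ : ℝ) (u : ℝ → ℝ) : Prop where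
  rlDifferentiable : RLDifferentiable a β u
  rlDifferentiable_seq : RLDifferentiable a β (seqRLDeriv a β 1 u)
  equation : ∀ t, a < t →
    seqRLDeriv a β 2 u t + a₁ * seqRLDeriv a β 1 u t + a₀ * u t = 0

/-- The two-parameter Mittag-Leffler function on the real line. -/
def mittagLeffler (α β z : ℝ) : ℝ := ∑' k : ℕ, z ^ k / Real.Gamma (k * α + β)

end

open MeasureTheory Set

/-! The operator factors as `(D^β - r₁)(D^β - r₂)`, so `D^β u - r₂ u` and `D^β u - r₁ u` solve
first-order equations `D^β v = r v` with `r = r₁`, `r₂` respectively. Integrated once, such an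
equation reads `I^(1-β) v = c + r ∫ v`. Iterating it with the semigroup law expands `∫ v` into a
Mittag-Leffler series whose remainder tends to 0, hence `v = c * mlKernel β r (t - a)`
(`eq_const_mul_mlKernel`). Subtracting the two relations writes `u` as a combination of the kernels
for `r₁` and `r₂`.

For `r = -l < 0` the kernel is the Laplace transform of the nonnegative density `mlDensity β l`
(`mlKernel_neg_eq_mlMoment`). Both sides have Laplace transform `1 / (p^β + l)` for large `p`: the
kernel by summing a geometric series, the density by Fubini and a contour integral for its Stieltjes
transform. Uniqueness of Laplace transforms then identifies them.

Near 0 the density behaves like a constant times `x^β / l²`, so by scaling the kernel decays like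
`Γ(β+1) s^(-β-1) / l²` times that constant, and minus its derivative like `Γ(β+2) s^(-β-2) / l²`
times the same constant. The quotient gives `t u'/u → -(β+1)`, provided that the leading coefficient
of the combination is nonzero. This is what the non-degeneracy of the data says. -/

/-! ### Growth of Gamma and convergence of Mittag-Leffler series -/

/-- Keep only the part of the Gamma integral beyond `M`, where `t^(x-1) ≥ M^(x-1)`. Since `M` is
arbitrary, Gamma outgrows every exponential. -/
theorem Real.rpow_mul_exp_neg_le_Gamma {M x : ℝ} (hM : 0 < M) (hx : 1 ≤ x) :
    M ^ (x - 1) * Real.exp (-M) ≤ Real.Gamma x := by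
  have hx0 : 0 < x := by linarith
  rw [Real.Gamma_eq_integral hx0]
  have hI := Real.GammaIntegral_convergent hx0
  have hsub : Ioi M ⊆ Ioi (0 : ℝ) := Ioi_subset_Ioi hM.le
  calc M ^ (x - 1) * Real.exp (-M) = ∫ t in Ioi M, Real.exp (-t) * M ^ (x - 1) := by
        rw [integral_mul_const, integral_exp_neg_Ioi, mul_comm]
    _ ≤ ∫ t in Ioi M, Real.exp (-t) * t ^ (x - 1) := by
        refine setIntegral_mono_on ?_ (hI.mono_set hsub) measurableSet_Ioi ?_
        · exact (integrableOn_exp_neg_Ioi M).mul_const _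
        · intro t ht
          exact mul_le_mul_of_nonneg_left
            (Real.rpow_le_rpow hM.le (le_of_lt ht) (by linarith)) (Real.exp_pos _).le
    _ ≤ ∫ t in Ioi 0, Real.exp (-t) * t ^ (x - 1) := by
        refine setIntegral_mono_set hI ?_ hsub.eventuallyLE
        filter_upwards [ae_restrict_mem measurableSet_Ioi] with t ht
        exact mul_nonneg (Real.exp_pos _).le (Real.rpow_nonneg (le_of_lt ht) _)

theorem summable_pow_div_Gamma {β : ℝ} (hβ : 0 < β) (δ z : ℝ) :
    Summable fun k : ℕ => z ^ k / Real.Gamma (k * β + δ) := by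
  -- Chosen so that `M^β = 2(|z|+1)`, which bounds the terms by a multiple of `(1/2)^k`.
  set M : ℝ := (2 * (|z| + 1)) ^ (1 / β) with hMdef
  have hb : 0 < 2 * (|z| + 1) := by positivity
  have hM : 0 < M := Real.rpow_pos_of_pos hb _
  have hMβ : M ^ β = 2 * (|z| + 1) := by
    rw [hMdef, ← Real.rpow_mul hb.le, one_div, inv_mul_cancel₀ hβ.ne', Real.rpow_one]
  have hgeo : Summable fun k : ℕ => (1 / 2 : ℝ) ^ k * (Real.exp M * M ^ (1 - δ)) :=
    (summable_geometric_of_lt_one (by norm_num) (by norm_num)).mul_right _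
  refine Summable.of_norm_bounded_eventually_nat hgeo ?_
  have hev : ∀ᶠ k : ℕ in atTop, 1 ≤ (k : ℝ) * β + δ := by
    have : Tendsto (fun k : ℕ => (k : ℝ) * β + δ) atTop atTop :=
      tendsto_atTop_add_const_right _ _
        (tendsto_natCast_atTop_atTop.atTop_mul_const hβ)
    exact this.eventually_ge_atTop 1
  filter_upwards [hev] with k hk
  have hΓ := Real.rpow_mul_exp_neg_le_Gamma hM hk
  have hpos : 0 < M ^ ((k : ℝ) * β + δ - 1) * Real.exp (-M) :=
    mul_pos (Real.rpow_pos_of_pos hM _) (Real.exp_pos _)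
  have hΓpos : 0 < Real.Gamma (k * β + δ) := lt_of_lt_of_le hpos hΓ
  have hpow : M ^ ((k : ℝ) * β + δ - 1) = (2 * (|z| + 1)) ^ k * (M ^ (1 - δ))⁻¹ := by
    rw [show (k : ℝ) * β + δ - 1 = β * k + (-(1 - δ)) by ring, Real.rpow_add hM,
      Real.rpow_mul hM.le, hMβ, Real.rpow_natCast, Real.rpow_neg hM.le]
  rw [norm_div, norm_pow, Real.norm_eq_abs, Real.norm_eq_abs, abs_of_pos hΓpos]
  calc |z| ^ k / Real.Gamma (k * β + δ)
      ≤ (|z| + 1) ^ k / (M ^ ((k : ℝ) * β + δ - 1) * Real.exp (-M)) := by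
        gcongr
        linarith
    _ = (1 / 2 : ℝ) ^ k * (Real.exp M * M ^ (1 - δ)) := by
        have h1 : 0 < M ^ (1 - δ) := Real.rpow_pos_of_pos hM _
        rw [hpow, Real.exp_neg, mul_pow, one_div, inv_pow]
        field_simp

/-! ### Riemann-Liouville integrals and the semigroup law -/

theorem integrableOn_sub_rpow_mul_sub_rpow {α γ σ t : ℝ} (hα : 0 < α) (hγ : 0 < γ) (h : σ < t) :
    IntegrableOn (fun τ => (t - τ) ^ (α - 1) * (τ - σ) ^ (γ - 1)) (Ioo σ t) ∧
    ∫ τ in Ioo σ t, (t - τ) ^ (α - 1) * (τ - σ) ^ (γ - 1) =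
      Real.Gamma α * Real.Gamma γ / Real.Gamma (α + γ) * (t - σ) ^ (α + γ - 1) := by
  have hts : 0 < t - σ := sub_pos.2 h
  have key : ∫ τ in Ioo σ t, (t - τ) ^ (α - 1) * (τ - σ) ^ (γ - 1) =
      Real.Gamma α * Real.Gamma γ / Real.Gamma (α + γ) * (t - σ) ^ (α + γ - 1) := by
    have h1 := Complex.betaIntegral_scaled (γ : ℂ) (α : ℂ) hts
    rw [Complex.betaIntegral_eq_Gamma_mul_div (γ : ℂ) (α : ℂ) (by simpa) (by simpa)] at h1
    rw [← integral_Ioc_eq_integral_Ioo, ← intervalIntegral.integral_of_le h.le]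
    have h2 : ∫ τ in σ..t, (t - τ) ^ (α - 1) * (τ - σ) ^ (γ - 1) =
        ∫ x in (0 : ℝ)..(t - σ), (t - σ - x) ^ (α - 1) * x ^ (γ - 1) := by
      have := intervalIntegral.integral_comp_sub_right
        (fun x => (t - σ - x) ^ (α - 1) * x ^ (γ - 1)) σ (a := σ) (b := t)
      simp only [sub_self] at this
      rw [← this]
      refine intervalIntegral.integral_congr fun x _ => ?_
      congr 2
      ring
    rw [h2]
    have h3 : ∫ x in (0 : ℝ)..(t - σ), (x : ℂ) ^ ((γ : ℂ) - 1) * ((t - σ : ℝ) - x : ℂ) ^ ((α : ℂ) - 1)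
        = ((∫ x in (0 : ℝ)..(t - σ), (t - σ - x) ^ (α - 1) * x ^ (γ - 1) : ℝ) : ℂ) := by
      rw [← intervalIntegral.integral_ofReal]
      refine intervalIntegral.integral_congr fun x hx => ?_
      rw [uIcc_of_le hts.le] at hx
      rw [Complex.ofReal_mul, Complex.ofReal_cpow (by linarith [hx.2]), Complex.ofReal_cpow hx.1]
      push_cast
      ring
    rw [h3] at h1
    have h4 : (((t - σ : ℝ) : ℂ) ^ ((γ : ℂ) + α - 1) * (Complex.Gamma γ * Complex.Gamma α /
        Complex.Gamma (γ + α))) = ((Real.Gamma α * Real.Gamma γ / Real.Gamma (α + γ) *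
          (t - σ) ^ (α + γ - 1) : ℝ) : ℂ) := by
      rw [← Complex.ofReal_add γ α, Complex.Gamma_ofReal, Complex.Gamma_ofReal,
        Complex.Gamma_ofReal]
      push_cast [Complex.ofReal_cpow hts.le]
      rw [add_comm γ α, add_comm (γ : ℂ) α]
      ring
    rw [h4] at h1
    exact_mod_cast h1
  refine ⟨?_, key⟩
  -- A non-integrable function has integral 0 by convention, whereas the Beta value is positive.
  by_contra hcon
  have h0 := integral_undef (μ := volume.restrict (Ioo σ t)) hcon
  rw [h0] at key
  have : 0 < Real.Gamma α * Real.Gamma γ / Real.Gamma (α + γ) * (t - σ) ^ (α + γ - 1) := by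
    have := Real.Gamma_pos_of_pos hα
    have := Real.Gamma_pos_of_pos hγ
    have := Real.Gamma_pos_of_pos (add_pos hα hγ)
    have := Real.rpow_pos_of_pos hts (α + γ - 1)
    positivity
  linarith

theorem rlIntegral_eq_setIntegral {a t : ℝ} (h : a ≤ t) (α : ℝ) (f : ℝ → ℝ) :
    rlIntegral a α f t = 1 / Real.Gamma α * ∫ τ in Ioo a t, (t - τ) ^ (α - 1) * f τ := by
  rw [rlIntegral, intervalIntegral.integral_of_le h, integral_Ioc_eq_integral_Ioo]

theorem rlIntegral_congr {a t : ℝ} (h : a ≤ t) (α : ℝ) {f g : ℝ → ℝ}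
    (hfg : ∀ τ, a < τ → f τ = g τ) : rlIntegral a α f t = rlIntegral a α g t := by
  rw [rlIntegral_eq_setIntegral h, rlIntegral_eq_setIntegral h]
  congr 1
  exact setIntegral_congr_fun measurableSet_Ioo fun τ hτ => by simp only [hfg τ hτ.1]

theorem rlIntegral_one_order {a : ℝ} (f : ℝ → ℝ) (t : ℝ) :
    rlIntegral a 1 f t = ∫ τ in a..t, f τ := by
  simp [rlIntegral]

theorem integrableOn_sub_rpow {a t α : ℝ} (hα : 0 < α) (h : a < t) :
    IntegrableOn (fun τ => (t - τ) ^ (α - 1)) (Ioo a t) := by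
  simpa using (integrableOn_sub_rpow_mul_sub_rpow hα one_pos h).1

theorem integrableOn_sub_rpow_mul {a t α : ℝ} (hα : 0 < α) (h : a < t) {f : ℝ → ℝ}
    (hf : ContinuousOn f (Ioi a)) (hfi : IntegrableOn f (Ioo a t)) :
    IntegrableOn (fun τ => (t - τ) ^ (α - 1) * f τ) (Ioo a t) := by
  obtain ⟨m, ham, hmt⟩ := exists_between h
  have h1 : IntegrableOn (fun τ => (t - τ) ^ (α - 1) * f τ) (Ioc a m) := by
    refine IntegrableOn.continuousOn_mul_of_subset (K := Icc a m) ?_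
      (hfi.mono_set fun x hx => ⟨hx.1, hx.2.trans_lt hmt⟩) isCompact_Icc
      measurableSet_Ioc Ioc_subset_Icc_self
    exact (continuousOn_const.sub continuousOn_id).rpow_const fun x hx =>
      Or.inl (sub_pos.2 (lt_of_le_of_lt hx.2 hmt)).ne'
  have h2 : IntegrableOn (fun τ => (t - τ) ^ (α - 1) * f τ) (Ioo m t) := by
    refine IntegrableOn.mul_continuousOn_of_subset (K := Icc m t)
      (integrableOn_sub_rpow hα hmt) ?_ measurableSet_Ioo isCompact_Icc Ioo_subset_Icc_self
    exact hf.mono fun x hx => lt_of_lt_of_le ham hx.1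
  refine (h1.union h2).mono_set fun x hx => ?_
  rcases le_or_gt x m with hxm | hxm
  · exact Or.inl ⟨hx.1, hxm⟩
  · exact Or.inr ⟨hxm, hx.2⟩

/-- Semigroup property of the Riemann-Liouville integrals at a point `t`. -/
theorem rlIntegral_rlIntegral {a t α γ : ℝ} (hα : 0 < α) (hγ : 0 < γ) (h : a < t) {f : ℝ → ℝ}
    (hf : IntegrableOn f (Ioo a t))
    (hfi : IntegrableOn (fun σ => (t - σ) ^ (α + γ - 1) * f σ) (Ioo a t)) :
    rlIntegral a α (rlIntegral a γ f) t = rlIntegral a (α + γ) f t := by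
  set μ : Measure ℝ := volume.restrict (Ioo a t) with hμ
  -- Extending the kernel by zero off the triangle `σ < τ` turns the iterated integral into one over
  -- a square, where Fubini applies; the inner integrals in `τ` are Beta integrals.
  set k : ℝ × ℝ → ℝ := {p : ℝ × ℝ | p.2 < p.1}.indicator
    fun p => (t - p.1) ^ (α - 1) * (p.1 - p.2) ^ (γ - 1) with hk
  have hkm : Measurable k := by
    refine Measurable.indicator ?_ (measurableSet_lt measurable_snd measurable_fst)
    exact ((measurable_const.sub measurable_fst).pow_const _).mul
      ((measurable_fst.sub measurable_snd).pow_const _)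
  set B : ℝ := Real.Gamma α * Real.Gamma γ / Real.Gamma (α + γ) with hB
  have hleft : ∀ σ ∈ Ioo a t, ∀ x : ℝ, (fun τ => k (τ, σ) * x) =
      (Ioi σ).indicator fun τ => (t - τ) ^ (α - 1) * (τ - σ) ^ (γ - 1) * x := by
    intro σ hσ x
    ext τ
    by_cases hτ : σ < τ <;> simp [hk, indicator, hτ]
  have hinterL : ∀ σ ∈ Ioo a t, Ioo a t ∩ Ioi σ = Ioo σ t := by
    intro σ hσ
    ext x
    simp only [mem_inter_iff, mem_Ioo, mem_Ioi]
    exact ⟨fun hx => ⟨hx.2, hx.1.2⟩, fun hx => ⟨⟨hσ.1.trans hx.1, hx.2⟩, hx.1⟩⟩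
  have hint : ∀ σ ∈ Ioo a t, ∀ x : ℝ, Integrable (fun τ => k (τ, σ) * x) μ := by
    intro σ hσ x
    rw [hleft σ hσ x, hμ, integrable_indicator_iff measurableSet_Ioi, IntegrableOn,
      Measure.restrict_restrict measurableSet_Ioi, inter_comm, hinterL σ hσ]
    exact (integrableOn_sub_rpow_mul_sub_rpow hα hγ hσ.2).1.mul_const x
  have hval : ∀ σ ∈ Ioo a t, ∀ x : ℝ, ∫ τ, k (τ, σ) * x ∂μ =
      B * ((t - σ) ^ (α + γ - 1) * x) := by
    intro σ hσ x
    rw [hleft σ hσ x, hμ, setIntegral_indicator measurableSet_Ioi, hinterL σ hσ,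
      integral_mul_const, (integrableOn_sub_rpow_mul_sub_rpow hα hγ hσ.2).2, hB]
    ring
  have hknn : ∀ σ ∈ Ioo a t, ∀ τ ∈ Ioo a t, 0 ≤ k (τ, σ) := by
    intro σ _ τ hτ
    refine indicator_apply_nonneg fun hlt => ?_
    have hlt : σ < τ := hlt
    exact mul_nonneg (Real.rpow_nonneg (by linarith [hτ.2]) _)
      (Real.rpow_nonneg (by linarith) _)
  have hprod : Integrable (Function.uncurry fun τ σ => k (τ, σ) * f σ) (μ.prod μ) := by
    have hms : AEStronglyMeasurable (Function.uncurry fun τ σ => k (τ, σ) * f σ) (μ.prod μ) :=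
      hkm.aestronglyMeasurable.mul hf.aestronglyMeasurable.comp_snd
    rw [integrable_prod_iff' hms]
    constructor
    · filter_upwards [ae_restrict_mem measurableSet_Ioo] with σ hσ
      exact hint σ hσ (f σ)
    · have : Integrable (fun σ => B * ‖(t - σ) ^ (α + γ - 1) * f σ‖) μ := hfi.norm.const_mul B
      refine this.congr ?_
      filter_upwards [ae_restrict_mem measurableSet_Ioo] with σ hσ
      rw [norm_mul, Real.norm_of_nonneg (Real.rpow_nonneg (by linarith [hσ.2]) _),
        ← hval σ hσ ‖f σ‖]
      refine integral_congr_ae ?_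
      filter_upwards [ae_restrict_mem measurableSet_Ioo] with τ hτ
      simp only [Function.uncurry, norm_mul]
      rw [Real.norm_of_nonneg (hknn σ hσ τ hτ)]
  have hswap := integral_integral_swap hprod
  have hR : ∫ σ, ∫ τ, k (τ, σ) * f σ ∂μ ∂μ =
      B * ∫ σ in Ioo a t, (t - σ) ^ (α + γ - 1) * f σ := by
    rw [← integral_const_mul]
    refine integral_congr_ae ?_
    filter_upwards [ae_restrict_mem measurableSet_Ioo] with σ hσ
    exact hval σ hσ (f σ)
  have hL : ∫ τ, ∫ σ, k (τ, σ) * f σ ∂μ ∂μ =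
      ∫ τ in Ioo a t, Real.Gamma γ * ((t - τ) ^ (α - 1) * rlIntegral a γ f τ) := by
    refine integral_congr_ae ?_
    filter_upwards [ae_restrict_mem measurableSet_Ioo] with τ hτ
    have h1 : (fun σ => k (τ, σ) * f σ) =
        (Iio τ).indicator fun σ => (t - τ) ^ (α - 1) * ((τ - σ) ^ (γ - 1) * f σ) := by
      ext σ
      by_cases hσ : σ < τ <;> simp [hk, indicator, hσ, mul_assoc]
    have h2 : Ioo a t ∩ Iio τ = Ioo a τ := by
      ext x
      simp only [mem_inter_iff, mem_Ioo, mem_Iio]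
      exact ⟨fun hx => ⟨hx.1.1, hx.2⟩, fun hx => ⟨⟨hx.1, hx.2.trans hτ.2⟩, hx.2⟩⟩
    rw [h1, hμ, setIntegral_indicator measurableSet_Iio, h2, integral_const_mul,
      rlIntegral_eq_setIntegral hτ.1.le]
    have := (Real.Gamma_pos_of_pos hγ).ne'
    field_simp
  rw [hL, hR, integral_const_mul] at hswap
  rw [rlIntegral_eq_setIntegral h.le, rlIntegral_eq_setIntegral h.le]
  have hα' := (Real.Gamma_pos_of_pos hα).ne'
  have hγ' := (Real.Gamma_pos_of_pos hγ).ne'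
  have hαγ := (Real.Gamma_pos_of_pos (add_pos hα hγ)).ne'
  have hs : ∫ τ in Ioo a t, (t - τ) ^ (α - 1) * rlIntegral a γ f τ =
      (Real.Gamma γ)⁻¹ * (B * ∫ σ in Ioo a t, (t - σ) ^ (α + γ - 1) * f σ) := by
    rw [← hswap, inv_mul_cancel_left₀ hγ']
  rw [hs, hB]
  field_simp

theorem rlIntegral_add_const_mul {a t α : ℝ} (hα : 0 < α) (h : a < t) (c r : ℝ) {g : ℝ → ℝ}
    (hg : IntegrableOn (fun τ => (t - τ) ^ (α - 1) * g τ) (Ioo a t)) :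
    rlIntegral a α (fun τ => c + r * g τ) t =
      c * ((t - a) ^ α / Real.Gamma (α + 1)) + r * rlIntegral a α g t := by
  rw [rlIntegral_eq_setIntegral h.le, rlIntegral_eq_setIntegral h.le]
  have h1 := integrableOn_sub_rpow (a := a) hα h
  have h2 : ∫ τ in Ioo a t, (t - τ) ^ (α - 1) = (t - a) ^ α / α := by
    have := (integrableOn_sub_rpow_mul_sub_rpow hα one_pos h).2
    simp only [sub_self, Real.rpow_zero, mul_one, Real.Gamma_one, add_sub_cancel_right] at this
    rw [this, Real.Gamma_add_one hα.ne']
    have := (Real.Gamma_pos_of_pos hα).ne'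
    field_simp
  have h3 : ∀ τ, (t - τ) ^ (α - 1) * (c + r * g τ) =
      c * (t - τ) ^ (α - 1) + r * ((t - τ) ^ (α - 1) * g τ) := fun τ => by ring
  simp only [h3]
  rw [integral_add (h1.const_mul c) (hg.const_mul r), integral_const_mul, integral_const_mul, h2,
    Real.Gamma_add_one hα.ne']
  have := (Real.Gamma_pos_of_pos hα).ne'
  field_simp

theorem abs_rlIntegral_one_add_le {a t α : ℝ} (hα : 0 ≤ α) (h : a < t) {f : ℝ → ℝ}
    (hf : IntegrableOn f (Ioo a t)) :
    |rlIntegral a (1 + α) f t| ≤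
      (t - a) ^ α / Real.Gamma (α + 1) * ∫ τ in Ioo a t, |f τ| := by
  have hΓ : 0 < Real.Gamma (α + 1) := Real.Gamma_pos_of_pos (by linarith)
  rw [rlIntegral_eq_setIntegral h.le, abs_mul, add_comm 1 α, abs_of_pos (by positivity),
    div_mul_eq_mul_div, div_mul_eq_mul_div, one_mul, ← integral_const_mul]
  gcongr
  refine norm_integral_le_of_norm_le (f := fun τ => (t - τ) ^ (α + 1 - 1) * f τ)
    (hf.abs.const_mul _) ?_
  filter_upwards [ae_restrict_mem measurableSet_Ioo] with τ hτ
  rw [add_sub_cancel_right, norm_mul, Real.norm_eq_abs, Real.norm_eq_abs,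
    abs_of_nonneg (Real.rpow_nonneg (by linarith [hτ.2]) _)]
  gcongr
  · linarith [hτ.2]
  · exact hτ.1.le

/-! ### The first-order equation as an iterated integral equation -/

theorem intervalIntegrable_of_integrableOn_Ioo {a : ℝ} {f : ℝ → ℝ}
    (hfi : ∀ t, a < t → IntegrableOn f (Ioo a t)) {t : ℝ} (h : a < t) :
    IntervalIntegrable f volume a t :=
  (intervalIntegrable_iff_integrableOn_Ioo_of_le h.le).2 (hfi t h)

theorem hasDerivAt_primitive {a : ℝ} {f : ℝ → ℝ} (hf : ContinuousOn f (Ioi a))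
    (hfi : ∀ t, a < t → IntegrableOn f (Ioo a t)) {t : ℝ} (h : a < t) :
    HasDerivAt (fun t => ∫ τ in a..t, f τ) (f t) t := by
  have hc : ContinuousAt f t := hf.continuousAt (Ioi_mem_nhds h)
  exact intervalIntegral.integral_hasDerivAt_right (intervalIntegrable_of_integrableOn_Ioo hfi h)
    (hf.stronglyMeasurableAtFilter isOpen_Ioi t h) hc

theorem continuousOn_primitive_Icc {a : ℝ} {f : ℝ → ℝ}
    (hfi : ∀ t, a < t → IntegrableOn f (Ioo a t)) {t : ℝ} (h : a < t) :
    ContinuousOn (fun t => ∫ τ in a..t, f τ) (Icc a t) := by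
  have := intervalIntegral.continuousOn_primitive_interval
    (f := f) (μ := volume) (a := a) (b := t)
    ((intervalIntegrable_iff_integrableOn_Icc_of_le h.le).1
      (intervalIntegrable_of_integrableOn_Ioo hfi h) |>.mono_set (by rw [uIcc_of_le h.le]))
  rwa [uIcc_of_le h.le] at this

/-- A solution of `D^β v = r v` satisfies an integral equation whose constant term is the limit of
`I^(1-β) v` at the lower terminal. -/
theorem exists_rlIntegral_eq_add_primitive {a r α : ℝ} {v : ℝ → ℝ} (hv : ContinuousOn v (Ioi a))
    (hvi : ∀ t, a < t → IntegrableOn v (Ioo a t))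
    (hd : ∀ t, a < t → HasDerivAt (rlIntegral a α v) (r * v t) t) :
    ∃ c, (∀ t, a < t → rlIntegral a α v t = c + r * ∫ τ in a..t, v τ) ∧
      Tendsto (rlIntegral a α v) (𝓝[>] a) (𝓝 c) := by
  set V : ℝ → ℝ := fun t => ∫ τ in a..t, v τ with hV
  have hdiff : ∀ t, a < t → HasDerivAt (fun t => rlIntegral a α v t - r * V t) 0 t := by
    intro t ht
    have := (hd t ht).sub ((hasDerivAt_primitive hv hvi ht).const_mul r)
    rwa [sub_self] at this
  obtain ⟨c, hc⟩ := isOpen_Ioi.exists_is_const_of_deriv_eq_zero isPreconnected_Ioi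
    (fun t ht => (hdiff t ht).differentiableAt.differentiableWithinAt)
    (fun t ht => (hdiff t ht).deriv)
  have hw : ∀ t, a < t → rlIntegral a α v t = c + r * V t := fun t ht => by
    linarith [hc t ht]
  refine ⟨c, hw, ?_⟩
  have hV0 : Tendsto V (𝓝[>] a) (𝓝 0) := by
    have h1 := continuousOn_primitive_Icc hvi (lt_add_one a) a ⟨le_rfl, by linarith⟩
    have h2 : Tendsto V (𝓝[Icc a (a + 1)] a) (𝓝 (V a)) := h1
    have h3 : V a = 0 := by simp [hV]
    rw [h3] at h2
    refine h2.mono_left ?_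
    rw [← nhdsWithin_Ioo_eq_nhdsGT (lt_add_one a)]
    exact nhdsWithin_mono _ Ioo_subset_Icc_self
  have h4 : Tendsto (fun t => c + r * V t) (𝓝[>] a) (𝓝 (c + r * 0)) :=
    tendsto_const_nhds.add (hV0.const_mul r)
  rw [mul_zero, add_zero] at h4
  refine h4.congr' ?_
  filter_upwards [self_mem_nhdsWithin] with t ht
  exact (hw t ht).symm

/-- Picard iteration: split the remainder `I^(1+nβ) v` as `I^((n+1)β) I^(1-β) v` and insert the
integral equation. The constant `c` yields the next term and `r ∫ v` the next remainder. -/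
theorem primitive_eq_partial_sum_add {a β r c : ℝ} (hβ0 : 0 < β) (hβ1 : β < 1) {v : ℝ → ℝ}
    (hv : ContinuousOn v (Ioi a)) (hvi : ∀ t, a < t → IntegrableOn v (Ioo a t))
    (hw : ∀ t, a < t → rlIntegral a (1 - β) v t = c + r * ∫ τ in a..t, v τ)
    {t : ℝ} (ht : a < t) (n : ℕ) :
    ∫ τ in a..t, v τ =
      c * ∑ k ∈ Finset.range n, r ^ k * ((t - a) ^ ((k + 1) * β) / Real.Gamma ((k + 1) * β + 1)) +
        r ^ n * rlIntegral a (1 + n * β) v t := by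
  induction n with
  | zero => simp [rlIntegral_one_order]
  | succ n ih =>
    have hpos : 0 < ((n : ℝ) + 1) * β := by positivity
    have hVi : IntegrableOn (fun t => ∫ τ in a..t, v τ) (Ioo a t) :=
      (continuousOn_primitive_Icc hvi ht).integrableOn_Icc.mono_set Ioo_subset_Icc_self
    have hVc : ContinuousOn (fun t => ∫ τ in a..t, v τ) (Ioi a) := fun s hs =>
      (hasDerivAt_primitive hv hvi hs).continuousAt.continuousWithinAt
    have h1 : rlIntegral a (1 + n * β) v t =
        rlIntegral a ((n + 1) * β) (rlIntegral a (1 - β) v) t := by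
      rw [rlIntegral_rlIntegral hpos (by linarith) ht (hvi t ht)
        (integrableOn_sub_rpow_mul (by linarith) ht hv (hvi t ht))]
      congr 1
      ring
    have h2 : rlIntegral a ((n + 1) * β) (fun t => ∫ τ in a..t, v τ) t =
        rlIntegral a (1 + (n + 1 : ℕ) * β) v t := by
      have h3 : (fun t => ∫ τ in a..t, v τ) = rlIntegral a 1 v := by
        ext s
        exact (rlIntegral_one_order v s).symm
      rw [h3, rlIntegral_rlIntegral hpos one_pos ht (hvi t ht)
        (integrableOn_sub_rpow_mul (by linarith) ht hv (hvi t ht))]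
      congr 1
      push_cast
      ring
    rw [rlIntegral_congr ht.le _ hw,
      rlIntegral_add_const_mul hpos ht c r (integrableOn_sub_rpow_mul hpos ht hVc hVi), h2] at h1
    rw [ih, h1, Finset.sum_range_succ]
    ring

/-- The `n`-th remainder is at most the `n`-th term of a convergent Mittag-Leffler series times `∫
|v|`, so it vanishes in the limit. Integrability of `v` suffices; no bound near `a` is needed. -/
theorem primitive_eq_tsum {a β r c : ℝ} (hβ0 : 0 < β) (hβ1 : β < 1) {v : ℝ → ℝ}
    (hv : ContinuousOn v (Ioi a)) (hvi : ∀ t, a < t → IntegrableOn v (Ioo a t))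
    (hw : ∀ t, a < t → rlIntegral a (1 - β) v t = c + r * ∫ τ in a..t, v τ)
    {t : ℝ} (ht : a < t) :
    ∫ τ in a..t, v τ =
      c * ∑' k : ℕ, r ^ k * ((t - a) ^ ((k + 1) * β) / Real.Gamma ((k + 1) * β + 1)) := by
  have hta : 0 < t - a := sub_pos.2 ht
  have hsum : Summable fun k : ℕ =>
      r ^ k * ((t - a) ^ (((k : ℝ) + 1) * β) / Real.Gamma ((k + 1) * β + 1)) := by
    refine ((summable_pow_div_Gamma hβ0 (β + 1) (r * (t - a) ^ β)).mul_left
      ((t - a) ^ β)).congr fun k => ?_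
    rw [show ((k : ℝ) + 1) * β = β * k + β by ring, Real.rpow_add hta, Real.rpow_mul hta.le,
      Real.rpow_natCast, mul_pow, show (k : ℝ) * β + (β + 1) = β * k + β + 1 by ring]
    ring
  have hrem : Tendsto (fun n : ℕ => r ^ n * rlIntegral a (1 + n * β) v t) atTop (𝓝 0) := by
    have h0 := (((summable_pow_div_Gamma hβ0 1 (|r| * (t - a) ^ β)).mul_right
      (∫ τ in Ioo a t, |v τ|)).tendsto_atTop_zero)
    refine squeeze_zero_norm (fun n => ?_) h0
    rw [norm_mul, norm_pow, Real.norm_eq_abs, Real.norm_eq_abs]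
    calc |r| ^ n * |rlIntegral a (1 + n * β) v t|
        ≤ |r| ^ n * ((t - a) ^ (n * β) / Real.Gamma (n * β + 1) * ∫ τ in Ioo a t, |v τ|) := by
          gcongr
          exact abs_rlIntegral_one_add_le (by positivity) ht (hvi t ht)
      _ = (|r| * (t - a) ^ β) ^ n / Real.Gamma (n * β + 1) * ∫ τ in Ioo a t, |v τ| := by
          rw [mul_pow, ← Real.rpow_natCast ((t - a) ^ β), ← Real.rpow_mul hta.le, mul_comm β]
          ring
  have hlim := (hsum.hasSum.tendsto_sum_nat.const_mul c).add hrem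
  rw [add_zero] at hlim
  refine tendsto_nhds_unique (Tendsto.congr (fun n => ?_) tendsto_const_nhds) hlim
  exact primitive_eq_partial_sum_add hβ0 hβ1 hv hvi hw ht n

/-! ### The Mittag-Leffler kernel and its Laplace transform -/

theorem continuous_mittagLeffler {α : ℝ} (hα : 0 < α) (β : ℝ) :
    Continuous (mittagLeffler α β) := by
  rw [continuous_iff_continuousAt]
  intro z
  have hs : Icc (z - 1) (z + 1) ∈ 𝓝 z := Icc_mem_nhds (by linarith) (by linarith)
  refine ContinuousOn.continuousAt (s := Icc (z - 1) (z + 1)) ?_ hs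
  refine continuousOn_tsum (u := fun k : ℕ => ‖(|z| + 1) ^ k / Real.Gamma (k * α + β)‖)
    (fun k => ((continuous_pow k).div_const _).continuousOn)
    (summable_pow_div_Gamma hα β (|z| + 1)).norm fun k x hx => ?_
  have hx' : |x| ≤ |z| + 1 := by
    have h1 : |x - z| ≤ 1 := abs_le.2 ⟨by linarith [hx.1], by linarith [hx.2]⟩
    calc |x| = |z + (x - z)| := by ring_nf
      _ ≤ |z| + |x - z| := abs_add_le _ _
      _ ≤ |z| + 1 := by linarith
  rw [norm_div, norm_div, norm_pow, norm_pow, Real.norm_eq_abs x,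
    Real.norm_of_nonneg (by positivity : 0 ≤ |z| + 1)]
  gcongr

/-- The solution `s ^ (β - 1) * E_{β,β}(r s^β)` of `D^β v = r v` on `(0, ∞)`. -/
noncomputable def mlKernel (β r s : ℝ) : ℝ := s ^ (β - 1) * mittagLeffler β β (r * s ^ β)

/-- The terms of the power series of `mlKernel`. -/
noncomputable def mlKernelTerm (β r : ℝ) (k : ℕ) (s : ℝ) : ℝ :=
  r ^ k * (s ^ ((k + 1) * β - 1) / Real.Gamma ((k + 1) * β))

theorem abs_mlKernelTerm {β s : ℝ} (hβ : 0 < β) (r : ℝ) (hs : 0 ≤ s) (k : ℕ) :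
    |mlKernelTerm β r k s| = mlKernelTerm β |r| k s := by
  have h1 := Real.Gamma_pos_of_pos (show 0 < ((k : ℝ) + 1) * β by positivity)
  have h2 := Real.rpow_nonneg hs (((k : ℝ) + 1) * β - 1)
  rw [mlKernelTerm, mlKernelTerm, abs_mul, abs_pow, abs_div, abs_of_nonneg h2, abs_of_pos h1]

theorem hasSum_mlKernelTerm {β s : ℝ} (hβ : 0 < β) (hs : 0 < s) (r : ℝ) :
    HasSum (fun k => mlKernelTerm β r k s) (mlKernel β r s) := by
  have h := (summable_pow_div_Gamma hβ β (r * s ^ β)).hasSum.mul_left (s ^ (β - 1))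
  refine h.congr_fun fun k => ?_
  rw [mlKernelTerm, show ((k : ℝ) + 1) * β - 1 = β - 1 + β * k by ring, Real.rpow_add hs,
    Real.rpow_mul hs.le, Real.rpow_natCast, mul_pow, show ((k : ℝ) + 1) * β = k * β + β by ring]
  ring

theorem continuousOn_mlKernel {β : ℝ} (hβ : 0 < β) (r : ℝ) :
    ContinuousOn (mlKernel β r) (Ioi 0) := by
  have h1 : ∀ γ : ℝ, ContinuousOn (fun s : ℝ => s ^ γ) (Ioi 0) := fun γ =>
    continuousOn_id.rpow_const fun x hx => Or.inl (ne_of_gt hx)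
  exact (h1 _).mul ((continuous_mittagLeffler hβ β).comp_continuousOn
    (continuousOn_const.mul (h1 β)))

theorem abs_mlKernel_le {β s : ℝ} (hβ : 0 < β) (r : ℝ) (hs : 0 < s) :
    |mlKernel β r s| ≤ mlKernel β |r| s := by
  rw [← (hasSum_mlKernelTerm hβ hs r).tsum_eq]
  exact tsum_of_norm_bounded (f := fun k => mlKernelTerm β r k s) (hasSum_mlKernelTerm hβ hs |r|) fun k =>
    (abs_mlKernelTerm hβ r hs.le k).le

theorem integrableOn_mlKernel {β : ℝ} (hβ : 0 < β) (r T : ℝ) :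
    IntegrableOn (mlKernel β r) (Ioo 0 T) := by
  rcases le_or_gt T 0 with hT | hT
  · simp [Ioo_eq_empty hT.not_gt]
  · refine IntegrableOn.mul_continuousOn_of_subset (K := Icc 0 T) ?_ ?_ measurableSet_Ioo
      isCompact_Icc Ioo_subset_Icc_self
    · exact (intervalIntegrable_iff_integrableOn_Ioo_of_le hT.le).1
        (intervalIntegral.intervalIntegrable_rpow' (by linarith))
    · exact ((continuous_mittagLeffler hβ β).comp
        (continuous_const.mul (Real.continuous_rpow_const hβ.le))).continuousOn

/-- Termwise integration reproduces the series found in `primitive_eq_tsum`. A solution is then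
identified by comparing derivatives of two primitives, so that no series has to be differentiated.
-/
theorem integral_mlKernel {β T : ℝ} (hβ : 0 < β) (hT : 0 < T) (r : ℝ) :
    ∫ s in Ioo 0 T, mlKernel β r s =
      ∑' k : ℕ, r ^ k * (T ^ ((k + 1) * β) / Real.Gamma ((k + 1) * β + 1)) := by
  have hint : ∀ (r : ℝ) (k : ℕ), Integrable (mlKernelTerm β r k) (volume.restrict (Ioo 0 T)) := by
    intro r k
    have hk : 0 < ((k : ℝ) + 1) * β := by positivity
    refine Integrable.const_mul (Integrable.div_const ?_ _) _
    exact (intervalIntegrable_iff_integrableOn_Ioo_of_le hT.le).1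
        (intervalIntegral.intervalIntegrable_rpow' (by linarith))
  have hval : ∀ (r : ℝ) (k : ℕ), ∫ s in Ioo 0 T, mlKernelTerm β r k s =
      r ^ k * (T ^ (((k : ℝ) + 1) * β) / Real.Gamma ((k + 1) * β + 1)) := by
    intro r k
    have hk : 0 < ((k : ℝ) + 1) * β := by positivity
    simp only [mlKernelTerm]
    rw [integral_const_mul, integral_div, ← integral_Ioc_eq_integral_Ioo,
      ← intervalIntegral.integral_of_le hT.le, integral_rpow (Or.inl (by linarith)),
      Real.Gamma_add_one hk.ne', sub_add_cancel, Real.zero_rpow hk.ne']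
    have := (Real.Gamma_pos_of_pos hk).ne'
    field_simp
    ring
  have hsum : ∀ r : ℝ, Summable fun k : ℕ =>
      r ^ k * (T ^ (((k : ℝ) + 1) * β) / Real.Gamma ((k + 1) * β + 1)) := by
    intro r
    refine ((summable_pow_div_Gamma hβ (β + 1) (r * T ^ β)).mul_left (T ^ β)).congr fun k => ?_
    rw [show ((k : ℝ) + 1) * β = β * k + β by ring, Real.rpow_add hT, Real.rpow_mul hT.le,
      Real.rpow_natCast, mul_pow, show (k : ℝ) * β + (β + 1) = β * k + β + 1 by ring]
    ring
  have h := hasSum_integral_of_summable_integral_norm (hint r) ?_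
  · simp only [hval] at h
    rw [h.tsum_eq]
    refine setIntegral_congr_fun measurableSet_Ioo fun s hs => ?_
    exact (hasSum_mlKernelTerm hβ hs.1 r).tsum_eq.symm
  · refine (hsum |r|).congr fun k => ?_
    rw [← hval]
    refine setIntegral_congr_fun measurableSet_Ioo fun s hs => ?_
    rw [Real.norm_eq_abs, abs_mlKernelTerm hβ r hs.1.le]

/-- Each term contributes a Gamma integral that cancels its denominator, leaving a geometric series
in `r / p^β`. The bound on `|r|` makes it converge absolutely, which justifies the exchange of sum
and integral. -/
theorem integral_exp_neg_mul_mlKernel {β p r : ℝ} (hβ : 0 < β) (hp : 0 < p) (hr : |r| < p ^ β) :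
    ∫ s in Ioi 0, Real.exp (-(p * s)) * mlKernel β r s = 1 / (p ^ β - r) := by
  have hpβ : 0 < p ^ β := Real.rpow_pos_of_pos hp β
  have hval : ∀ (r : ℝ) (k : ℕ), ∫ s in Ioi 0, Real.exp (-(p * s)) * mlKernelTerm β r k s =
      (r / p ^ β) ^ k * (1 / p ^ β) := by
    intro r k
    have hk : 0 < ((k : ℝ) + 1) * β := by positivity
    have h1 : ∀ s : ℝ, Real.exp (-(p * s)) * mlKernelTerm β r k s =
        r ^ k / Real.Gamma ((k + 1) * β) *
          (s ^ (((k : ℝ) + 1) * β - 1) * Real.exp (-(p * s))) := by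
      intro s
      rw [mlKernelTerm]
      ring
    simp only [h1]
    rw [integral_const_mul, Real.integral_rpow_mul_exp_neg_mul_Ioi hk hp, one_div,
      Real.inv_rpow hp.le, show ((k : ℝ) + 1) * β = β * k + β by ring, Real.rpow_add hp,
      Real.rpow_mul hp.le, Real.rpow_natCast, div_pow]
    have := (Real.Gamma_pos_of_pos (show 0 < β * k + β by positivity)).ne'
    field_simp
  have hint : ∀ (r : ℝ) (k : ℕ), IntegrableOn
      (fun s => Real.exp (-(p * s)) * mlKernelTerm β r k s) (Ioi 0) := by
    intro r k
    -- Integrability is read off from a nonzero integral; for `r = 0` this fails when `k > 0`, but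
    -- the term is then identically zero.
    rcases eq_or_ne r 0 with rfl | hr0
    · rcases Nat.eq_zero_or_pos k with rfl | hk
      · refine Integrable.of_integral_ne_zero ?_
        rw [hval]
        simp [hpβ.ne']
      · simp [mlKernelTerm, hk.ne']
    · refine Integrable.of_integral_ne_zero ?_
      rw [hval]
      positivity
  have hgeo : ∀ r : ℝ, |r| < p ^ β → HasSum (fun k : ℕ => (r / p ^ β) ^ k * (1 / p ^ β))
      (1 / (p ^ β - r)) := by
    intro r hr
    have h1 : |r / p ^ β| < 1 := by
      rw [abs_div, abs_of_pos hpβ, div_lt_one hpβ]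
      exact hr
    convert! (hasSum_geometric_of_abs_lt_one h1).mul_right (1 / p ^ β) using 1
    have : p ^ β - r ≠ 0 := by linarith [le_abs_self r]
    field_simp
  have h := hasSum_integral_of_summable_integral_norm (hint r) ?_
  · simp only [hval] at h
    rw [← (hgeo r hr).tsum_eq, h.tsum_eq]
    refine setIntegral_congr_fun measurableSet_Ioi fun s hs => ?_
    rw [tsum_mul_left, (hasSum_mlKernelTerm hβ hs r).tsum_eq]
  · refine (hgeo |r| (by rwa [abs_abs])).summable.congr fun k => ?_
    rw [← hval]
    refine setIntegral_congr_fun measurableSet_Ioi fun s hs => ?_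
    rw [norm_mul, Real.norm_eq_abs (mlKernelTerm _ _ _ _), abs_mlKernelTerm hβ r (le_of_lt hs),
      Real.norm_of_nonneg (Real.exp_pos _).le]

theorem integrableOn_exp_neg_mul_mlKernel {β p r : ℝ} (hβ : 0 < β) (hp : 0 < p)
    (hr : |r| < p ^ β) :
    IntegrableOn (fun s => Real.exp (-(p * s)) * mlKernel β r s) (Ioi 0) := by
  have h1 : IntegrableOn (fun s => Real.exp (-(p * s)) * mlKernel β |r| s) (Ioi 0) := by
    refine Integrable.of_integral_ne_zero ?_
    rw [integral_exp_neg_mul_mlKernel hβ hp (by rwa [abs_abs])]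
    exact (one_div_pos.2 (sub_pos.2 hr)).ne'
  refine h1.mono' (ContinuousOn.aestronglyMeasurable ?_ measurableSet_Ioi) ?_
  · exact (by fun_prop : Continuous fun s : ℝ => Real.exp (-(p * s))).continuousOn.mul
      (continuousOn_mlKernel hβ r)
  · filter_upwards [ae_restrict_mem measurableSet_Ioi] with s hs
    rw [norm_mul, Real.norm_of_nonneg (Real.exp_pos _).le]
    exact mul_le_mul_of_nonneg_left (abs_mlKernel_le hβ r hs) (Real.exp_pos _).le

/-- Solutions of `D^β v = r v` are the multiples of the Mittag-Leffler kernel. -/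
theorem eq_const_mul_mlKernel {a β r c : ℝ} (hβ0 : 0 < β) (hβ1 : β < 1) {v : ℝ → ℝ}
    (hv : ContinuousOn v (Ioi a)) (hvi : ∀ t, a < t → IntegrableOn v (Ioo a t))
    (hw : ∀ t, a < t → rlIntegral a (1 - β) v t = c + r * ∫ τ in a..t, v τ)
    {t : ℝ} (ht : a < t) : v t = c * mlKernel β r (t - a) := by
  have hta : 0 < t - a := sub_pos.2 ht
  have h1 := hasDerivAt_primitive hv hvi ht
  have h2 : HasDerivAt (fun s => ∫ τ in (0 : ℝ)..s, mlKernel β r τ) (mlKernel β r (t - a))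
      (t - a) :=
    hasDerivAt_primitive (continuousOn_mlKernel hβ0 r)
      (fun T _ => integrableOn_mlKernel hβ0 r T) hta
  have h3 := (h2.comp_sub_const t a).const_mul c
  refine h1.unique (h3.congr_of_eventuallyEq ?_)
  filter_upwards [Ioi_mem_nhds ht] with s hs
  have hs : 0 < s - a := sub_pos.2 hs
  rw [primitive_eq_tsum hβ0 hβ1 hv hvi hw (sub_pos.1 hs),
    intervalIntegral.integral_of_le hs.le, integral_Ioc_eq_integral_Ioo,
    integral_mlKernel hβ0 hs]

/-! ### The spectral density and its Stieltjes transform -/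

/-- The spectral density of the Mittag-Leffler kernel: `mlKernel β (-l)` is its Laplace
transform. -/
noncomputable def mlDensity (β l x : ℝ) : ℝ :=
  Real.sin (Real.pi * β) / Real.pi *
    (x ^ β / ((x ^ β + l * Real.cos (Real.pi * β)) ^ 2 + (l * Real.sin (Real.pi * β)) ^ 2))

theorem sin_pi_mul_pos {β : ℝ} (hβ0 : 0 < β) (hβ1 : β < 1) : 0 < Real.sin (Real.pi * β) :=
  Real.sin_pos_of_pos_of_lt_pi (by positivity) (by nlinarith [Real.pi_pos])

theorem mlDensity_nonneg {β x : ℝ} (hβ0 : 0 < β) (hβ1 : β < 1) (l : ℝ) (hx : 0 ≤ x) :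
    0 ≤ mlDensity β l x := by
  have := sin_pi_mul_pos hβ0 hβ1
  have := Real.pi_pos
  have := Real.rpow_nonneg hx β
  unfold mlDensity
  positivity

/-- Convergence along `comap Complex.re l` is uniform in the imaginary part, so the integrands are
eventually bounded by a constant and dominated convergence applies. It handles the vertical sides of
the contour. -/
theorem tendsto_intervalIntegral_vertical {f : ℂ → ℂ} {l : Filter ℝ} [l.IsCountablyGenerated]
    {L : ℂ} (hf : Tendsto f (comap Complex.re l) (𝓝 L)) (a b : ℝ)
    (hc : ∀ x : ℝ, Continuous fun y : uIcc a b => f (x + y * Complex.I)) :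
    Tendsto (fun x : ℝ => ∫ y in a..b, f (x + y * Complex.I)) l (𝓝 ((b - a) * L)) := by
  have hlim : ∀ y : ℝ, Tendsto (fun x : ℝ => (x + y * Complex.I : ℂ)) l (comap Complex.re l) := by
    intro y
    rw [tendsto_comap_iff]
    exact tendsto_id.congr fun x => by simp
  have hbd : ∀ᶠ x : ℝ in l, ∀ y : ℝ, ‖f (x + y * Complex.I)‖ ≤ ‖L‖ + 1 := by
    have h1 : ∀ᶠ z in comap Complex.re l, ‖f z‖ < ‖L‖ + 1 :=
      hf.norm.eventually_lt_const (lt_add_one _)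
    rw [eventually_comap] at h1
    filter_upwards [h1] with x hx y
    exact (hx _ (by simp)).le
  have h := intervalIntegral.tendsto_integral_filter_of_dominated_convergence (μ := volume)
    (l := l) (F := fun (x y : ℝ) => f (x + y * Complex.I)) (f := fun _ => L) (a := a) (b := b)
    (fun _ => ‖L‖ + 1) (Eventually.of_forall fun x => ?_) (hbd.mono fun x hx =>
      Eventually.of_forall fun y _ => hx y) intervalIntegrable_const
    (Eventually.of_forall fun y _ => hf.comp (hlim y))
  · simpa using h
  · refine ContinuousOn.aestronglyMeasurable ?_ measurableSet_uIoc
    exact (continuousOn_iff_continuous_domRestrict.2 (hc x)).mono uIoc_subset_uIcc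

/-- In this strip `β z` has imaginary part in `(-π, π)`, so its exponential is never a negative
real. -/
theorem exp_mul_add_ne_zero {β l : ℝ} (hβ : 0 < β) (hl : 0 < l) {z : ℂ}
    (hz : |z.im| < Real.pi / β) : Complex.exp (β * z) + l ≠ 0 := by
  intro h
  have hre := congrArg Complex.re h
  have him := congrArg Complex.im h
  simp only [Complex.add_re, Complex.add_im, Complex.exp_re, Complex.exp_im, Complex.re_ofReal_mul,
    Complex.im_ofReal_mul, Complex.ofReal_re, Complex.ofReal_im, Complex.zero_re, Complex.zero_im,
    add_zero] at hre him
  have hz : |β * z.im| < Real.pi := by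
    rw [abs_mul, abs_of_pos hβ, mul_comm]
    exact (lt_div_iff₀ hβ).1 hz
  have hs : Real.sin (β * z.im) = 0 := by
    rcases mul_eq_zero.1 him with h0 | h0
    · exact absurd h0 (Real.exp_pos _).ne'
    · exact h0
  rw [(Real.sin_eq_zero_iff_of_lt_of_lt (abs_lt.1 hz).1 (abs_lt.1 hz).2).1 hs,
    Real.cos_zero] at hre
  linarith [Real.exp_pos (β * z.re)]

/-- With `w = x^β` and `θ = πβ` this is the jump of `1 / (z^β + l)` across the negative axis, which
is where `mlDensity` comes from. -/
theorem one_div_sub_one_div_eq_sin (w l θ : ℝ)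
    (h1 : (w : ℂ) * Complex.exp (-(θ * Complex.I)) + l ≠ 0)
    (h2 : (w : ℂ) * Complex.exp (θ * Complex.I) + l ≠ 0) :
    1 / ((w : ℂ) * Complex.exp (-(θ * Complex.I)) + l) -
      1 / ((w : ℂ) * Complex.exp (θ * Complex.I) + l) =
    2 * Complex.I * ((Real.sin θ * (w / ((w + l * Real.cos θ) ^ 2 + (l * Real.sin θ) ^ 2)) : ℝ)
      : ℂ) := by
  have e2 : Complex.exp (θ * Complex.I) = Complex.cos θ + Complex.sin θ * Complex.I :=
    Complex.exp_mul_I θ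
  have e1 : Complex.exp (-(θ * Complex.I)) = Complex.cos θ - Complex.sin θ * Complex.I := by
    rw [← neg_mul, Complex.exp_mul_I, Complex.cos_neg, Complex.sin_neg]
    ring
  rw [e1] at h1 ⊢
  rw [e2] at h2 ⊢
  have hsc : Complex.sin θ ^ 2 + Complex.cos θ ^ 2 = 1 := Complex.sin_sq_add_cos_sq _
  have hI := Complex.I_sq
  have hD : ((w : ℂ) + l * Complex.cos θ) ^ 2 + (l * Complex.sin θ) ^ 2 =
      (w * (Complex.cos θ - Complex.sin θ * Complex.I) + l) *
        (w * (Complex.cos θ + Complex.sin θ * Complex.I) + l) := by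
    linear_combination (l ^ 2 - w ^ 2 : ℂ) * hsc + (w ^ 2 * Complex.sin θ ^ 2 : ℂ) * hI
  push_cast
  rw [hD, div_sub_div _ _ h1 h2, mul_div_assoc', mul_div_assoc']
  congr 1
  ring

/-- Away from `c` the function is `(F z - F c) e^z / (e^z - e^c)` with `F z = 1 / (e^(βz) + l)`.
Subtracting `F c` removes the pole at `c`, and the `dslope` form extends the quotient
holomorphically through it. -/
theorem differentiableOn_contour_integrand {β l c : ℝ} (hβ0 : 0 < β) (hβ1 : β < 1) (hl : 0 < l) :
    DifferentiableOn ℂ (fun z : ℂ =>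
      dslope (fun z : ℂ => 1 / (Complex.exp (β * z) + l)) c z * Complex.exp z /
        dslope Complex.exp c z) {z | |z.im| ≤ Real.pi} := by
  -- The first bound keeps `F` free of poles; the second leaves `c` as the only solution of `e^z =
  -- e^c`. Since `β < 1`, this open strip contains the closed strip `|Im z| ≤ π`.
  set U : Set ℂ := {z | |z.im| < Real.pi / β ∧ |z.im| < 2 * Real.pi} with hU
  have hUo : IsOpen U :=
    (isOpen_lt (continuous_abs.comp Complex.continuous_im) continuous_const).inter
      (isOpen_lt (continuous_abs.comp Complex.continuous_im) continuous_const)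
  have hcU : U ∈ 𝓝 (c : ℂ) := hUo.mem_nhds (by
    simp only [hU, mem_ofPred_eq, Complex.ofReal_im, abs_zero]
    exact ⟨div_pos Real.pi_pos hβ0, by positivity⟩)
  have hF : DifferentiableOn ℂ (fun z : ℂ => 1 / (Complex.exp (β * z) + l)) U := fun z hz =>
    ((differentiableAt_const _).div
      (by fun_prop : DifferentiableAt ℂ (fun z : ℂ => Complex.exp (β * z) + l) z)
      (exp_mul_add_ne_zero hβ0 hl hz.1)).differentiableWithinAt
  refine DifferentiableOn.mono (t := U) ?_ fun z hz => ?_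
  · refine DifferentiableOn.div (((Complex.differentiableOn_dslope hcU).2 hF).mul
      Complex.differentiable_exp.differentiableOn)
      ((Complex.differentiableOn_dslope hcU).2 Complex.differentiable_exp.differentiableOn) ?_
    intro z hz
    rcases eq_or_ne z c with rfl | hzc
    · rw [dslope_same, Complex.deriv_exp]
      exact Complex.exp_ne_zero _
    · rw [dslope_of_ne _ hzc, slope_def_field]
      refine div_ne_zero (sub_ne_zero.2 fun h => ?_) (sub_ne_zero.2 hzc)
      obtain ⟨n, hn⟩ := Complex.exp_eq_exp_iff_exists_int.1 h
      have him : z.im = n * (2 * Real.pi) := by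
        rw [hn]
        simp
      have hlt := hz.2
      rw [him, abs_mul, abs_of_pos Real.two_pi_pos] at hlt
      have : |(n : ℝ)| < 1 := by
        by_contra hcon
        nlinarith [Real.two_pi_pos]
      have hn0 : n = 0 := by
        rw [← Int.cast_abs] at this
        exact Int.abs_lt_one_iff.1 (by exact_mod_cast this)
      exact hzc (by rw [hn, hn0]; simp)
  · have hz : |z.im| ≤ Real.pi := hz
    have hpi := Real.pi_pos
    exact ⟨lt_of_le_of_lt hz (by rw [lt_div_iff₀ hβ0]; nlinarith), by linarith⟩

theorem contour_integrand_of_ne {F : ℂ → ℂ} {c z : ℂ} (h : z ≠ c) :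
    dslope F c z * Complex.exp z / dslope Complex.exp c z =
      (F z - F c) * (Complex.exp z / (Complex.exp z - Complex.exp c)) := by
  rw [dslope_of_ne _ h, dslope_of_ne _ h, slope_def_field, slope_def_field]
  have := sub_ne_zero.2 h
  field_simp

/-- Cauchy's theorem on the rectangle `[-R, R] × [-π, π]`, in the variable `z = log x`, so that the
two sides of the cut become the horizontal edges. There `e^z = -e^x`, the constants `F c` cancel,
and the difference is `2πi` times the integrand. The left edge tends to 0 and the right edge gives
`F c`. -/
theorem tendsto_integral_mlDensity_exp {β l : ℝ} (hβ0 : 0 < β) (hβ1 : β < 1) (hl : 0 < l) (c : ℝ) :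
    Tendsto (fun R : ℝ => ∫ x in (-R)..R, mlDensity β l (Real.exp x) *
      (Real.exp x / (Real.exp x + Real.exp c))) atTop (𝓝 (1 / (Real.exp (β * c) + l))) := by
  set F : ℂ → ℂ := fun z => 1 / (Complex.exp (β * z) + l) with hF
  set Φ : ℂ → ℂ := fun z => dslope F c z * Complex.exp z / dslope Complex.exp c z with hΦ
  have hdiff := differentiableOn_contour_integrand (c := c) hβ0 hβ1 hl
  have hpi := Real.pi_pos
  have hmul : ∀ l : Filter ℝ, Tendsto (fun x => β * x) l l →
      Tendsto (fun z : ℂ => (β : ℂ) * z) (comap Complex.re l) (comap Complex.re l) := by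
    intro l h
    rw [tendsto_comap_iff]
    exact (h.comp tendsto_comap).congr fun z => by simp
  have hvc : ∀ x : ℝ, Continuous fun y : uIcc (-Real.pi) Real.pi => Φ (x + y * Complex.I) := by
    intro x
    refine hdiff.continuousOn.comp_continuous (by fun_prop) fun y => ?_
    obtain ⟨y, hy⟩ := y
    rw [uIcc_of_le (by linarith)] at hy
    simpa [abs_le] using hy
  have htop : Tendsto Φ (comap Complex.re atTop) (𝓝 (-F c)) := by
    have h1 : Tendsto F (comap Complex.re atTop) (𝓝 0) := by
      have h2 : Tendsto (fun z : ℂ => Complex.exp (β * z) + l) (comap Complex.re atTop)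
          (Bornology.cobounded ℂ) :=
        tendsto_add_const_cobounded _ |>.comp
          (Complex.tendsto_exp_comap_re_atTop.comp
            (hmul atTop (tendsto_id.const_mul_atTop hβ0)))
      exact (tendsto_inv₀_cobounded.comp h2).congr fun z => (one_div _).symm
    have h3 : Tendsto (fun z : ℂ => 1 / (1 - Complex.exp c * (Complex.exp z)⁻¹))
        (comap Complex.re atTop) (𝓝 (1 / (1 - Complex.exp c * 0))) :=
      tendsto_const_nhds.div (tendsto_const_nhds.sub ((tendsto_inv₀_cobounded.comp
        Complex.tendsto_exp_comap_re_atTop).const_mul _)) (by simp)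
    have h4 := (h1.sub_const (F c)).mul h3
    simp only [mul_zero, sub_zero, div_one, mul_one, zero_sub] at h4
    refine h4.congr' ?_
    filter_upwards [preimage_mem_comap (Ioi_mem_atTop c)] with z hz
    have hzc : z ≠ c := by
      rintro rfl
      simp at hz
    refine Eq.trans ?_ (contour_integrand_of_ne hzc).symm
    congr 1
    rw [← div_eq_mul_inv, one_sub_div (Complex.exp_ne_zero z), one_div_div]
  have hbot : Tendsto Φ (comap Complex.re atBot) (𝓝 0) := by
    have h0 := Complex.tendsto_exp_comap_re_atBot
    have h1 : Tendsto F (comap Complex.re atBot) (𝓝 (1 / (0 + l))) :=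
      tendsto_const_nhds.div ((h0.comp
        (hmul atBot (tendsto_id.const_mul_atBot hβ0))).add_const _)
        (by simpa using hl.ne')
    have h3 : Tendsto (fun z : ℂ => Complex.exp z / (Complex.exp z - Complex.exp c))
        (comap Complex.re atBot) (𝓝 (0 / (0 - Complex.exp c))) :=
      h0.div (h0.sub_const _) (by simp)
    have h4 := (h1.sub_const (F c)).mul h3
    rw [zero_div, mul_zero] at h4
    refine h4.congr' ?_
    filter_upwards [preimage_mem_comap (Iio_mem_atBot c)] with z hz
    have hzc : z ≠ c := by
      rintro rfl
      simp at hz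
    exact (contour_integrand_of_ne hzc).symm
  have hR := tendsto_intervalIntegral_vertical htop (-Real.pi) Real.pi hvc
  have hL := (tendsto_intervalIntegral_vertical hbot (-Real.pi) Real.pi hvc).comp
    tendsto_neg_atTop_atBot
  have hrect : ∀ R : ℝ, 2 * Real.pi * Complex.I * ((∫ x in (-R)..R, mlDensity β l (Real.exp x) *
      (Real.exp x / (Real.exp x + Real.exp c)) : ℝ) : ℂ) =
      Complex.I * (∫ y in (-Real.pi)..Real.pi, Φ ((-R : ℝ) + y * Complex.I)) -
      Complex.I * ∫ y in (-Real.pi)..Real.pi, Φ (R + y * Complex.I) := by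
    intro R
    have hrec := Complex.integral_boundary_rect_eq_zero_of_differentiableOn Φ
      ((-R : ℝ) + (-Real.pi : ℝ) * Complex.I) (R + Real.pi * Complex.I) ?_
    · have e1 : ((-R : ℝ) + (-Real.pi : ℝ) * Complex.I : ℂ).re = -R := by simp
      have e2 : ((-R : ℝ) + (-Real.pi : ℝ) * Complex.I : ℂ).im = -Real.pi := by simp
      have e3 : (R + Real.pi * Complex.I : ℂ).re = R := by simp
      have e4 : (R + Real.pi * Complex.I : ℂ).im = Real.pi := by simp
      rw [e1, e2, e3, e4] at hrec
      have hh : ∀ s : ℝ, |s| ≤ Real.pi → IntervalIntegrable (fun x : ℝ => Φ (x + s * Complex.I))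
          volume (-R) R := by
        intro s hs
        refine (hdiff.continuousOn.comp_continuous (by fun_prop) fun x => ?_).intervalIntegrable
          _ _
        simpa using hs
      rw [← intervalIntegral.integral_sub (hh _ (by simp [abs_of_pos hpi]))
        (hh _ (by simp [abs_of_pos hpi]))] at hrec
      have hint : ∀ x : ℝ, Φ (x + (-Real.pi : ℝ) * Complex.I) - Φ (x + Real.pi * Complex.I) =
          2 * Real.pi * Complex.I * ((mlDensity β l (Real.exp x) *
            (Real.exp x / (Real.exp x + Real.exp c)) : ℝ) : ℂ) := by
        intro x
        have n1 : (x + (-Real.pi : ℝ) * Complex.I : ℂ) ≠ c := fun h => by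
          have := congrArg Complex.im h
          simp at this
        have n2 : (x + Real.pi * Complex.I : ℂ) ≠ c := fun h => by
          have := congrArg Complex.im h
          simp at this
        have x1 : Complex.exp (x + (-Real.pi : ℝ) * Complex.I) = -(Real.exp x : ℂ) := by
          rw [Complex.exp_add, Complex.ofReal_neg, neg_mul, Complex.exp_neg, Complex.exp_pi_mul_I,
            Complex.ofReal_exp]
          norm_num
        have x2 : Complex.exp (x + Real.pi * Complex.I) = -(Real.exp x : ℂ) := by
          rw [Complex.exp_add, Complex.exp_pi_mul_I, Complex.ofReal_exp]
          norm_num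
        have x3 : -(Real.exp x : ℂ) / (-(Real.exp x : ℂ) - Complex.exp c) =
            ((Real.exp x / (Real.exp x + Real.exp c) : ℝ) : ℂ) := by
          push_cast
          rw [← neg_add', neg_div_neg_eq]
        have y1 : Complex.exp (β * (x + (-Real.pi : ℝ) * Complex.I)) =
            ((Real.exp x ^ β : ℝ) : ℂ) * Complex.exp (-((Real.pi * β : ℝ) * Complex.I)) := by
          rw [← Real.exp_mul, Complex.ofReal_exp, ← Complex.exp_add]
          congr 1
          push_cast
          ring
        have y2 : Complex.exp (β * (x + Real.pi * Complex.I)) =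
            ((Real.exp x ^ β : ℝ) : ℂ) * Complex.exp ((Real.pi * β : ℝ) * Complex.I) := by
          rw [← Real.exp_mul, Complex.ofReal_exp, ← Complex.exp_add]
          congr 1
          push_cast
          ring
        have hlt : Real.pi < Real.pi / β := by
          rw [lt_div_iff₀ hβ0]
          nlinarith
        have z1 := exp_mul_add_ne_zero hβ0 hl (z := x + (-Real.pi : ℝ) * Complex.I)
          (by simpa [abs_of_pos hpi] using hlt)
        have z2 := exp_mul_add_ne_zero hβ0 hl (z := x + Real.pi * Complex.I)
          (by simpa [abs_of_pos hpi] using hlt)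
        have hΦ1 : Φ (x + (-Real.pi : ℝ) * Complex.I) = (F (x + (-Real.pi : ℝ) * Complex.I) - F c) *
            ((Real.exp x / (Real.exp x + Real.exp c) : ℝ) : ℂ) := by
          exact (contour_integrand_of_ne n1).trans (by rw [x1, x3])
        have hΦ2 : Φ (x + Real.pi * Complex.I) = (F (x + Real.pi * Complex.I) - F c) *
            ((Real.exp x / (Real.exp x + Real.exp c) : ℝ) : ℂ) := by
          exact (contour_integrand_of_ne n2).trans (by rw [x2, x3])
        have hFF : F (x + (-Real.pi : ℝ) * Complex.I) - F (x + Real.pi * Complex.I) =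
            2 * Complex.I * (Real.pi * mlDensity β l (Real.exp x) : ℝ) := by
          rw [hF]
          rw [y1] at z1
          rw [y2] at z2
          simp only
          rw [y1, y2, one_div_sub_one_div_eq_sin _ _ _ z1 z2, mlDensity]
          congr 2
          field_simp
        rw [hΦ1, hΦ2, ← sub_mul, sub_sub_sub_cancel_right, hFF]
        push_cast
        ring
      simp only [hint] at hrec
      rw [intervalIntegral.integral_const_mul, intervalIntegral.integral_ofReal, smul_eq_mul,
        smul_eq_mul] at hrec
      linear_combination hrec
    · refine hdiff.mono fun z hz => ?_
      have := hz.2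
      simp only [Complex.add_im, Complex.ofReal_im, Complex.mul_im, Complex.I_im, Complex.I_re,
        Complex.ofReal_re, mul_one, mul_zero, add_zero, zero_add] at this
      rw [mem_preimage, uIcc_of_le (by linarith)] at this
      exact abs_le.2 this
  have hfin := ((hL.const_mul Complex.I).sub (hR.const_mul Complex.I)).congr fun R => (hrect R).symm
  have hfin2 := hfin.const_mul (2 * Real.pi * Complex.I : ℂ)⁻¹
  have hne : (2 * Real.pi * Complex.I : ℂ) ≠ 0 := by simp [hpi.ne']
  simp only [inv_mul_cancel_left₀ hne] at hfin2
  have hval : (2 * Real.pi * Complex.I : ℂ)⁻¹ * (Complex.I * ((Real.pi - (-Real.pi : ℝ)) * 0) -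
      Complex.I * ((Real.pi - (-Real.pi : ℝ)) * -F c)) =
      ((1 / (Real.exp (β * c) + l) : ℝ) : ℂ) := by
    rw [inv_mul_eq_iff_eq_mul₀ hne, hF]
    push_cast
    ring
  rw [hval] at hfin2
  exact Filter.tendsto_ofReal_iff.1 hfin2

/-- The substitution `x = e^y` undoes the logarithmic variable, with `p = e^c`. Nonnegativity
upgrades convergence of the symmetric truncations to integrability. -/
theorem integral_mlDensity_div_add {β l p : ℝ} (hβ0 : 0 < β) (hβ1 : β < 1) (hl : 0 < l)
    (hp : 0 < p) :
    IntegrableOn (fun x => mlDensity β l x / (x + p)) (Ioi 0) ∧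
    ∫ x in Ioi 0, mlDensity β l x / (x + p) = 1 / (p ^ β + l) := by
  set q : ℝ → ℝ := fun x => mlDensity β l (Real.exp x) * (Real.exp x / (Real.exp x + p)) with hq
  have hq0 : ∀ x, 0 ≤ q x := fun x =>
    mul_nonneg (mlDensity_nonneg hβ0 hβ1 l (Real.exp_pos x).le) (by positivity)
  have hlim : Tendsto (fun R : ℝ => ∫ x in (-R)..R, q x) atTop (𝓝 (1 / (p ^ β + l))) := by
    have h := tendsto_integral_mlDensity_exp hβ0 hβ1 hl (Real.log p)
    rwa [Real.exp_log hp, mul_comm β, ← Real.rpow_def_of_pos hp] at h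
  have hqc : Continuous q := by
    have hs := sin_pi_mul_pos hβ0 hβ1
    have h1 : Continuous fun x : ℝ => Real.exp x ^ β :=
      Real.continuous_exp.rpow_const fun x => Or.inl (Real.exp_pos x).ne'
    refine Continuous.mul (Continuous.mul continuous_const (h1.div (by fun_prop) fun x => ?_))
      (Real.continuous_exp.div (by fun_prop) fun x => by positivity)
    positivity
  have hqi : Integrable q := by
    refine integrable_of_intervalIntegral_norm_tendsto (l := atTop) (a := fun R : ℝ => -R)
      (b := fun R : ℝ => R) (1 / (p ^ β + l)) (fun R => ?_) tendsto_neg_atTop_atBot tendsto_id ?_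
    · exact (hqc.integrableOn_Icc).mono_set Ioc_subset_Icc_self
    · simpa only [Real.norm_of_nonneg (hq0 _)] using hlim
  have hint : ∫ x, q x = 1 / (p ^ β + l) := tendsto_nhds_unique
    (intervalIntegral_tendsto_integral hqi tendsto_neg_atTop_atBot tendsto_id) hlim
  have himg := integral_image_eq_integral_abs_deriv_smul (s := univ) MeasurableSet.univ
    (fun x _ => (Real.hasDerivAt_exp x).hasDerivWithinAt) Real.exp_injective.injOn
    (fun x => mlDensity β l x / (x + p))
  rw [image_univ, Real.range_exp, setIntegral_univ] at himg
  have hval : ∫ x in Ioi 0, mlDensity β l x / (x + p) = 1 / (p ^ β + l) := by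
    rw [himg, ← hint]
    refine integral_congr_ae (Eventually.of_forall fun x => ?_)
    simp only [hq, smul_eq_mul, abs_of_pos (Real.exp_pos x)]
    ring
  refine ⟨Integrable.of_integral_ne_zero ?_, hval⟩
  rw [hval]
  have := Real.rpow_pos_of_pos hp β
  positivity

/-- Dropping the first square of the denominator leaves a positive constant because `sin(πβ) > 0`.
The bound serves as the dominating function below. -/
theorem mlDensity_le {β l x : ℝ} (hβ0 : 0 < β) (hβ1 : β < 1) (hl : 0 < l) (hx : 0 ≤ x) :
    mlDensity β l x ≤
      Real.sin (Real.pi * β) / Real.pi / (l * Real.sin (Real.pi * β)) ^ 2 * x ^ β := by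
  have hs := sin_pi_mul_pos hβ0 hβ1
  have hpi := Real.pi_pos
  have hxβ := Real.rpow_nonneg hx β
  rw [mlDensity, div_mul_eq_mul_div _ ((l * _) ^ 2), mul_div_assoc]
  gcongr
  exact le_add_of_nonneg_left (sq_nonneg _)

theorem measurable_mlDensity (β l : ℝ) : Measurable (mlDensity β l) := by
  unfold mlDensity
  fun_prop

/-! ### Moments of the density and their asymptotics -/

theorem integrableOn_exp_neg_mul_rpow {γ s : ℝ} (hγ : -1 < γ) (hs : 0 < s) :
    IntegrableOn (fun x => Real.exp (-(s * x)) * x ^ γ) (Ioi 0) := by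
  have h := Real.integral_rpow_mul_exp_neg_mul_Ioi (a := γ + 1) (by linarith) hs
  simp only [add_sub_cancel_right, mul_comm (_ ^ γ)] at h
  refine Integrable.of_integral_ne_zero ?_
  rw [h]
  have := Real.Gamma_pos_of_pos (show 0 < γ + 1 by linarith)
  positivity

/-- Moments of the spectral density against a decaying exponential. -/
noncomputable def mlMoment (β l γ s : ℝ) : ℝ :=
  ∫ x in Ioi 0, Real.exp (-(s * x)) * (x ^ γ * mlDensity β l x)

theorem integrableOn_mlMoment {β l γ s : ℝ} (hβ0 : 0 < β) (hβ1 : β < 1) (hl : 0 < l) (hγ : 0 ≤ γ)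
    (hs : 0 < s) :
    IntegrableOn (fun x => Real.exp (-(s * x)) * (x ^ γ * mlDensity β l x)) (Ioi 0) := by
  have h := (integrableOn_exp_neg_mul_rpow (γ := γ + β) (by linarith) hs).const_mul
    (Real.sin (Real.pi * β) / Real.pi / (l * Real.sin (Real.pi * β)) ^ 2)
  refine h.mono' ?_ ?_
  · have := measurable_mlDensity β l
    exact Measurable.aestronglyMeasurable (by fun_prop)
  · filter_upwards [ae_restrict_mem measurableSet_Ioi] with x hx
    have hx : 0 < x := hx
    have hd := mlDensity_nonneg hβ0 hβ1 l hx.le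
    rw [Real.norm_of_nonneg (by positivity), Real.rpow_add hx]
    calc Real.exp (-(s * x)) * (x ^ γ * mlDensity β l x)
        ≤ Real.exp (-(s * x)) * (x ^ γ *
          (Real.sin (Real.pi * β) / Real.pi / (l * Real.sin (Real.pi * β)) ^ 2 * x ^ β)) := by
          gcongr
          exact mlDensity_le hβ0 hβ1 hl hx.le
      _ = _ := by ring

/-- Differentiating `e^(-sx)` brings down `-x`, which raises the exponent of the moment by one. On
`(s/2, ∞)` the derivative is dominated by its value at `s/2`. -/
theorem hasDerivAt_mlMoment {β l γ s : ℝ} (hβ0 : 0 < β) (hβ1 : β < 1) (hl : 0 < l) (hγ : 0 ≤ γ)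
    (hs : 0 < s) : HasDerivAt (mlMoment β l γ) (-mlMoment β l (γ + 1) s) s := by
  have hm := measurable_mlDensity β l
  have h := (hasDerivAt_integral_of_dominated_loc_of_deriv_le (μ := volume.restrict (Ioi 0))
    (F := fun s x => Real.exp (-(s * x)) * (x ^ γ * mlDensity β l x))
    (F' := fun s x => -(Real.exp (-(s * x)) * (x ^ (γ + 1) * mlDensity β l x)))
    (bound := fun x => Real.exp (-(s / 2 * x)) * (x ^ (γ + 1) * mlDensity β l x))
    (s := Ioi (s / 2)) (x₀ := s) (Ioi_mem_nhds (by linarith))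
    (Eventually.of_forall fun t => Measurable.aestronglyMeasurable (by fun_prop))
    (integrableOn_mlMoment hβ0 hβ1 hl hγ hs)
    (Measurable.aestronglyMeasurable (by fun_prop)) ?_
    (integrableOn_mlMoment hβ0 hβ1 hl (by linarith) (by linarith)) ?_).2
  · rw [integral_neg] at h
    exact h
  · filter_upwards [ae_restrict_mem measurableSet_Ioi] with x hx t ht
    have hx : 0 < x := hx
    have hd := mlDensity_nonneg hβ0 hβ1 l hx.le
    rw [norm_neg, Real.norm_of_nonneg (by positivity)]
    have ht : s / 2 < t := ht
    gcongr
  · filter_upwards [ae_restrict_mem measurableSet_Ioi] with x hx t _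
    have hx : 0 < x := hx
    have h1 : HasDerivAt (fun t : ℝ => Real.exp (-(t * x))) (Real.exp (-(t * x)) * (-(1 * x))) t :=
      (((hasDerivAt_id t).mul_const x).neg).exp
    convert! h1.mul_const (x ^ γ * mlDensity β l x) using 1
    rw [Real.rpow_add_one hx.ne']
    ring

/-- By Fubini the iterated Laplace transform is the Stieltjes transform of the density. -/
theorem integral_exp_neg_mul_mlMoment_zero {β l p : ℝ} (hβ0 : 0 < β) (hβ1 : β < 1) (hl : 0 < l)
    (hp : 0 < p) :
    ∫ s in Ioi 0, Real.exp (-(p * s)) * mlMoment β l 0 s = 1 / (p ^ β + l) := by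
  obtain ⟨hKi, hK⟩ := integral_mlDensity_div_add hβ0 hβ1 hl hp
  have hm := measurable_mlDensity β l
  set μ : Measure ℝ := volume.restrict (Ioi 0) with hμ
  have hexp : ∀ x, 0 < x → Integrable (fun s => Real.exp (-((x + p) * s))) μ ∧
      ∫ s, Real.exp (-((x + p) * s)) ∂μ = 1 / (x + p) := by
    intro x hx
    have hxp : 0 < x + p := by linarith
    have h1 := integrableOn_exp_neg_mul_rpow (γ := 0) (by norm_num) hxp
    have h2 := Real.integral_rpow_mul_exp_neg_mul_Ioi (a := 1) one_pos hxp
    simp only [Real.rpow_zero, mul_one, sub_self, one_mul, Real.rpow_one, Real.Gamma_one]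
      at h1 h2
    exact ⟨h1, h2⟩
  have hfun : ∀ s x : ℝ, Real.exp (-(p * s)) * (Real.exp (-(s * x)) * mlDensity β l x) =
      mlDensity β l x * Real.exp (-((x + p) * s)) := by
    intro s x
    rw [← mul_assoc, ← Real.exp_add, mul_comm]
    congr 2
    ring
  have hprod : Integrable (Function.uncurry fun s x =>
      Real.exp (-(p * s)) * (Real.exp (-(s * x)) * mlDensity β l x)) (μ.prod μ) := by
    have hms : Measurable (Function.uncurry fun s x =>
      Real.exp (-(p * s)) * (Real.exp (-(s * x)) * mlDensity β l x)) := by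
      unfold Function.uncurry
      fun_prop
    rw [integrable_prod_iff' hms.aestronglyMeasurable]
    simp only [Function.uncurry, hfun]
    constructor
    · filter_upwards [ae_restrict_mem measurableSet_Ioi] with x hx
      exact (hexp x hx).1.const_mul _
    · refine (show Integrable (fun x => mlDensity β l x / (x + p)) μ from hKi).congr ?_
      filter_upwards [ae_restrict_mem measurableSet_Ioi] with x hx
      have hx : 0 < x := hx
      simp only [norm_mul, Real.norm_of_nonneg (mlDensity_nonneg hβ0 hβ1 l hx.le),
        Real.norm_of_nonneg (Real.exp_pos _).le]
      rw [integral_const_mul, (hexp x hx).2, mul_one_div]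
  have hswap := integral_integral_swap hprod
  rw [← hK]
  calc ∫ s in Ioi 0, Real.exp (-(p * s)) * mlMoment β l 0 s
      = ∫ s, ∫ x, Real.exp (-(p * s)) * (Real.exp (-(s * x)) * mlDensity β l x) ∂μ ∂μ := by
        simp only [mlMoment, Real.rpow_zero, one_mul, integral_const_mul]
        rfl
    _ = ∫ x, ∫ s, Real.exp (-(p * s)) * (Real.exp (-(s * x)) * mlDensity β l x) ∂μ ∂μ := hswap
    _ = ∫ x, mlDensity β l x / (x + p) ∂μ := by
        refine integral_congr_ae ?_
        filter_upwards [ae_restrict_mem measurableSet_Ioi] with x hx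
        simp only [hfun]
        rw [integral_const_mul, (hexp x hx).2, mul_one_div]

/-- Watson's lemma: after `y = s x` the rescaled density `s^β mlDensity β l (y / s)` tends to
`sin(πβ) / π * y^β / l²`, and the remaining integral is a Gamma integral. Only the behaviour of the
density at 0 matters. -/
theorem tendsto_rpow_mul_mlMoment {β l γ : ℝ} (hβ0 : 0 < β) (hβ1 : β < 1) (hl : 0 < l)
    (hγ : 0 ≤ γ) :
    Tendsto (fun s => s ^ (β + γ + 1) * mlMoment β l γ s) atTop
      (𝓝 (Real.sin (Real.pi * β) / Real.pi / l ^ 2 * Real.Gamma (β + γ + 1))) := by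
  have hsin := sin_pi_mul_pos hβ0 hβ1
  have hm := measurable_mlDensity β l
  have hΓ : ∫ y in Ioi 0, Real.sin (Real.pi * β) / Real.pi / l ^ 2 *
      (Real.exp (-y) * y ^ (β + γ)) =
      Real.sin (Real.pi * β) / Real.pi / l ^ 2 * Real.Gamma (β + γ + 1) := by
    rw [integral_const_mul, Real.Gamma_eq_integral (by linarith)]
    simp only [add_sub_cancel_right]
  rw [← hΓ]
  have hD := tendsto_integral_filter_of_dominated_convergence (μ := volume.restrict (Ioi 0))
    (l := atTop)
    (F := fun s y => Real.exp (-y) * (y ^ γ * (s ^ β * mlDensity β l (s⁻¹ * y))))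
    (f := fun y => Real.sin (Real.pi * β) / Real.pi / l ^ 2 * (Real.exp (-y) * y ^ (β + γ)))
    (fun y => Real.sin (Real.pi * β) / Real.pi / (l * Real.sin (Real.pi * β)) ^ 2 *
      (Real.exp (-(1 * y)) * y ^ (β + γ)))
    (Eventually.of_forall fun s => Measurable.aestronglyMeasurable (by fun_prop)) ?_
    ((integrableOn_exp_neg_mul_rpow (by linarith) one_pos).const_mul _) ?_
  · refine hD.congr' ?_
    filter_upwards [eventually_gt_atTop 0] with s hs
    have h := integral_comp_mul_left_Ioi
      (fun y => Real.exp (-y) * (y ^ γ * (s ^ β * mlDensity β l (s⁻¹ * y)))) 0 hs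
    rw [mul_zero, smul_eq_mul, eq_inv_mul_iff_mul_eq₀ hs.ne', ← integral_const_mul] at h
    rw [← h, mlMoment, ← integral_const_mul]
    refine setIntegral_congr_fun measurableSet_Ioi fun x hx => ?_
    have hx : 0 < x := hx
    rw [inv_mul_cancel_left₀ hs.ne', Real.mul_rpow hs.le hx.le, Real.rpow_add_one hs.ne',
      Real.rpow_add hs]
    ring
  · filter_upwards [eventually_gt_atTop 0] with s hs
    filter_upwards [ae_restrict_mem measurableSet_Ioi] with y hy
    have hy : 0 < y := hy
    have hsy : 0 < s⁻¹ * y := by positivity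
    have hd := mlDensity_nonneg hβ0 hβ1 l hsy.le
    rw [Real.norm_of_nonneg (by positivity), one_mul, Real.rpow_add hy]
    calc Real.exp (-y) * (y ^ γ * (s ^ β * mlDensity β l (s⁻¹ * y)))
        ≤ Real.exp (-y) * (y ^ γ * (s ^ β * (Real.sin (Real.pi * β) / Real.pi /
          (l * Real.sin (Real.pi * β)) ^ 2 * (s⁻¹ * y) ^ β))) := by
          gcongr
          exact mlDensity_le hβ0 hβ1 hl hsy.le
      _ = _ := by
          rw [Real.mul_rpow (by positivity) hy.le, Real.inv_rpow hs.le]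
          have := (Real.rpow_pos_of_pos hs β).ne'
          field_simp
  · filter_upwards [ae_restrict_mem measurableSet_Ioi] with y hy
    have hy : 0 < y := hy
    have h0 : Tendsto (fun s : ℝ => (s⁻¹ * y) ^ β) atTop (𝓝 0) := by
      have h1 : Tendsto (fun s : ℝ => s⁻¹ * y) atTop (𝓝 (0 * y)) :=
        tendsto_inv_atTop_zero.mul_const y
      rw [zero_mul] at h1
      have h2 := h1.rpow_const (p := β) (Or.inr hβ0.le)
      rwa [Real.zero_rpow hβ0.ne'] at h2
    have h3 : Tendsto (fun s : ℝ => Real.sin (Real.pi * β) / Real.pi * (Real.exp (-y) *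
        y ^ (β + γ)) / (((s⁻¹ * y) ^ β + l * Real.cos (Real.pi * β)) ^ 2 +
          (l * Real.sin (Real.pi * β)) ^ 2)) atTop
        (𝓝 (Real.sin (Real.pi * β) / Real.pi * (Real.exp (-y) * y ^ (β + γ)) /
          ((0 + l * Real.cos (Real.pi * β)) ^ 2 + (l * Real.sin (Real.pi * β)) ^ 2))) :=
      tendsto_const_nhds.div (((h0.add_const _).pow 2).add_const _) (by positivity)
    have h4 : (0 + l * Real.cos (Real.pi * β)) ^ 2 + (l * Real.sin (Real.pi * β)) ^ 2 = l ^ 2 := by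
      linear_combination l ^ 2 * Real.sin_sq_add_cos_sq (Real.pi * β)
    rw [h4, mul_div_right_comm] at h3
    refine h3.congr' ?_
    filter_upwards [eventually_gt_atTop 0] with s hs
    have h5 : s ^ β * (s⁻¹ * y) ^ β = y ^ β := by
      rw [← Real.mul_rpow hs.le (by positivity), mul_inv_cancel_left₀ hs.ne']
    rw [mlDensity, Real.rpow_add hy, ← h5]
    ring

/-! ### Uniqueness of Laplace transforms and the spectral representation -/

/-- The positive and negative parts of `e^(-qs) f` are densities of two finite measures with equal
moment generating functions on `t < 1`. These continue analytically to `Re z < 1`, hence agree on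
the imaginary axis, so the characteristic functions and the measures coincide. -/
theorem eqOn_zero_of_laplace_eq_zero {f : ℝ → ℝ} {p₀ : ℝ} (hf : ContinuousOn f (Ioi 0))
    (hi : ∀ p, p₀ < p → IntegrableOn (fun s => Real.exp (-(p * s)) * f s) (Ioi 0))
    (h0 : ∀ p, p₀ < p → ∫ s in Ioi 0, Real.exp (-(p * s)) * f s = 0) :
    EqOn f (fun _ => 0) (Ioi 0) := by
  set ν : Measure ℝ := volume.restrict (Ioi 0) with hν
  -- The shift by 1 puts the imaginary axis strictly inside the half-plane of convergence.
  set q : ℝ := p₀ + 1 with hq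
  set h : ℝ → ℝ := fun s => Real.exp (-(q * s)) * f s with hh
  have hhi : Integrable h ν := hi q (by linarith)
  have key : ∀ σ : ℝ, AEMeasurable (fun s => (σ * h s).toNNReal) ν ∧
      IsFiniteMeasure (ν.withDensity fun s => ((σ * h s).toNNReal : ENNReal)) ∧
      ∀ t < 1, Integrable (fun s => Real.exp (t * s))
          (ν.withDensity fun s => ((σ * h s).toNNReal : ENNReal)) ∧
        Integrable (fun s => max (σ * h s) 0 * Real.exp (t * s)) ν ∧
        ∫ s, Real.exp (t * s) ∂(ν.withDensity fun s => ((σ * h s).toNNReal : ENNReal)) =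
          ∫ s, max (σ * h s) 0 * Real.exp (t * s) ∂ν := by
    intro σ
    have hms : AEMeasurable (fun s => (σ * h s).toNNReal) ν :=
      (hhi.const_mul σ).aestronglyMeasurable.aemeasurable.real_toNNReal
    refine ⟨hms, isFiniteMeasure_withDensity_ofReal (hhi.const_mul σ).2, fun t ht => ?_⟩
    have hint : Integrable (fun s => max (σ * h s) 0 * Real.exp (t * s)) ν := by
      have h1 : Integrable (fun s => Real.exp (-((q - t) * s)) * f s) ν := hi _ (by linarith)
      have h2 := h1.const_mul σ
      have h3 : (fun s => σ * (Real.exp (-((q - t) * s)) * f s)) =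
          fun s => (σ * h s) * Real.exp (t * s) := by
        ext s
        rw [hh, show -((q - t) * s) = -(q * s) + t * s by ring, Real.exp_add]
        ring
      rw [h3] at h2
      refine h2.pos_part.congr (Eventually.of_forall fun s => ?_)
      simp only
      rw [max_mul_of_nonneg _ _ (Real.exp_pos _).le, zero_mul]
    refine ⟨?_, hint, ?_⟩
    · rw [integrable_withDensity_iff_integrable_smul₀ hms]
      exact hint
    · rw [integral_withDensity_eq_integral_smul₀ hms]
      rfl
  obtain ⟨m1, fin1, k1⟩ := key 1
  obtain ⟨m2, fin2, k2⟩ := key (-1)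
  set μ₁ := ν.withDensity fun s => ((1 * h s).toNNReal : ENNReal) with hμ₁
  set μ₂ := ν.withDensity fun s => ((-1 * h s).toNNReal : ENNReal) with hμ₂
  have hmgf : ∀ t < 1, ProbabilityTheory.mgf id μ₁ t = ProbabilityTheory.mgf id μ₂ t := by
    intro t ht
    simp only [ProbabilityTheory.mgf, id]
    rw [(k1 t ht).2.2, (k2 t ht).2.2, ← sub_eq_zero,
      ← integral_sub (k1 t ht).2.1 (k2 t ht).2.1]
    refine Eq.trans ?_ (h0 (q - t) (by linarith))
    refine integral_congr_ae (Eventually.of_forall fun s => ?_)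
    simp only
    rw [← sub_mul, one_mul, neg_one_mul, max_zero_sub_max_neg_zero_eq_self, hh,
      show -((q - t) * s) = -(q * s) + t * s by ring, Real.exp_add]
    ring
  have hsub : ∀ μ : Measure ℝ, (∀ t < 1, Integrable (fun s => Real.exp (t * s)) μ) →
      {z : ℂ | z.re < 1} ⊆ {z | z.re ∈ interior (ProbabilityTheory.integrableExpSet id μ)} := by
    intro μ hμ z hz
    exact interior_maximal (s := ProbabilityTheory.integrableExpSet id μ) (t := Iio 1)
      (fun t ht => hμ t ht) isOpen_Iio hz
  have hA1 : AnalyticOnNhd ℂ (ProbabilityTheory.complexMGF id μ₁) {z : ℂ | z.re < 1} :=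
    ProbabilityTheory.analyticOnNhd_complexMGF.mono (hsub _ fun t ht => (k1 t ht).1)
  have hA2 : AnalyticOnNhd ℂ (ProbabilityTheory.complexMGF id μ₂) {z : ℂ | z.re < 1} :=
    ProbabilityTheory.analyticOnNhd_complexMGF.mono (hsub _ fun t ht => (k2 t ht).1)
  have heq : EqOn (ProbabilityTheory.complexMGF id μ₁) (ProbabilityTheory.complexMGF id μ₂)
      {z : ℂ | z.re < 1} := by
    refine hA1.eqOn_of_preconnected_of_frequently_eq hA2
      (convex_halfSpace_re_lt 1).isPreconnected (z₀ := 0) (by simp) ?_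
    have ht : Tendsto (fun x : ℝ => (x : ℂ)) (𝓝[≠] 0) (𝓝[≠] 0) := by
      rw [tendsto_nhdsWithin_iff]
      constructor
      · exact (Complex.continuous_ofReal.tendsto' 0 0 Complex.ofReal_zero).mono_left
          nhdsWithin_le_nhds
      · filter_upwards [self_mem_nhdsWithin] with x hx
        simpa using hx
    refine ht.frequently (Eventually.frequently ?_)
    filter_upwards [mem_nhdsWithin_of_mem_nhds (Iio_mem_nhds (zero_lt_one' ℝ))] with x hx
    rw [ProbabilityTheory.complexMGF_ofReal, ProbabilityTheory.complexMGF_ofReal, hmgf x hx]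
  have hμ : μ₁ = μ₂ := by
    refine Measure.ext_of_charFun (funext fun t => ?_)
    rw [← ProbabilityTheory.complexMGF_id_mul_I, ← ProbabilityTheory.complexMGF_id_mul_I]
    exact heq (by simp)
  have hae := (withDensity_eq_iff m1.coe_nnreal_ennreal m2.coe_nnreal_ennreal (by
    have := fin1.measure_univ_lt_top
    rw [hμ₁, withDensity_apply _ MeasurableSet.univ, Measure.restrict_univ] at this
    exact this.ne)).1 hμ
  refine Measure.eqOn_open_of_ae_eq (μ := volume) ?_ isOpen_Ioi hf continuousOn_const
  filter_upwards [hae] with s hs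
  have hs' : (1 * h s).toNNReal = (-1 * h s).toNNReal := ENNReal.coe_injective hs
  have hs2 : max (h s) 0 = max (-h s) 0 := by
    have := congrArg NNReal.toReal hs'
    simpa using this
  have hs3 : h s = 0 := by
    rcases le_total (h s) 0 with hle | hle
    · rw [max_eq_right hle, max_eq_left (by linarith)] at hs2
      linarith
    · rw [max_eq_left hle, max_eq_right (by linarith)] at hs2
      exact hs2
  exact (mul_eq_zero.1 hs3).resolve_left (Real.exp_pos _).ne'

/-- Both sides are continuous with Laplace transform `1 / (p^β + l)`. The threshold `p > l^(1/β)` is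
where the geometric series for the kernel converges. -/
theorem mlKernel_neg_eq_mlMoment {β l s : ℝ} (hβ0 : 0 < β) (hβ1 : β < 1) (hl : 0 < l)
    (hs : 0 < s) : mlKernel β (-l) s = mlMoment β l 0 s := by
  have hp : ∀ p, l ^ (1 / β) < p → 0 < p ∧ |(-l)| < p ^ β := by
    intro p hp
    have h1 : 0 < l ^ (1 / β) := Real.rpow_pos_of_pos hl _
    refine ⟨h1.trans hp, ?_⟩
    rw [abs_neg, abs_of_pos hl]
    calc l = (l ^ (1 / β)) ^ β := by
          rw [← Real.rpow_mul hl.le, one_div, inv_mul_cancel₀ hβ0.ne', Real.rpow_one]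
      _ < p ^ β := Real.rpow_lt_rpow h1.le hp hβ0
  have hi1 : ∀ p, l ^ (1 / β) < p →
      IntegrableOn (fun s => Real.exp (-(p * s)) * mlKernel β (-l) s) (Ioi 0) := fun p h =>
    integrableOn_exp_neg_mul_mlKernel hβ0 (hp p h).1 (hp p h).2
  have hi2 : ∀ p, l ^ (1 / β) < p →
      IntegrableOn (fun s => Real.exp (-(p * s)) * mlMoment β l 0 s) (Ioi 0) := by
    intro p h
    refine Integrable.of_integral_ne_zero ?_
    rw [integral_exp_neg_mul_mlMoment_zero hβ0 hβ1 hl (hp p h).1]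
    have := Real.rpow_pos_of_pos (hp p h).1 β
    positivity
  have h := eqOn_zero_of_laplace_eq_zero (f := fun s => mlKernel β (-l) s - mlMoment β l 0 s)
    (p₀ := l ^ (1 / β)) ?_ ?_ ?_ hs
  · exact sub_eq_zero.1 h
  · exact (continuousOn_mlKernel hβ0 (-l)).sub fun s hs =>
      (hasDerivAt_mlMoment hβ0 hβ1 hl le_rfl hs).continuousAt.continuousWithinAt
  · intro p h
    simp only [mul_sub]
    exact (hi1 p h).sub (hi2 p h)
  · intro p h
    simp only [mul_sub]
    rw [integral_sub (hi1 p h) (hi2 p h), integral_exp_neg_mul_mlKernel hβ0 (hp p h).1 (hp p h).2,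
      integral_exp_neg_mul_mlMoment_zero hβ0 hβ1 hl (hp p h).1, sub_neg_eq_add, sub_self]

/-! ### The sequential equation and the limit -/

theorem rlOrder_of_lt_one {β : ℝ} (hβ1 : β < 1) : rlOrder β = 1 := by
  rw [rlOrder, Nat.floor_eq_zero.2 hβ1]

theorem rlDeriv_of_lt_one {β : ℝ} (hβ1 : β < 1) (a : ℝ) (f : ℝ → ℝ) :
    rlDeriv a β f = deriv (rlIntegral a (1 - β) f) := by
  rw [rlDeriv, rlOrder_of_lt_one hβ1, iteratedDeriv_one, Nat.cast_one]

theorem RLDifferentiable.hasDerivAt {a β : ℝ} (hβ1 : β < 1) {f : ℝ → ℝ}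
    (hf : RLDifferentiable a β f) {t : ℝ} (ht : a < t) :
    HasDerivAt (rlIntegral a (1 - β) f) (rlDeriv a β f t) t := by
  have h := hf.differentiableAt t ht 0 (by rw [rlOrder_of_lt_one hβ1]; exact one_pos)
  rw [iteratedDeriv_zero, rlOrder_of_lt_one hβ1, Nat.cast_one] at h
  rw [rlDeriv_of_lt_one hβ1]
  exact h.hasDerivAt

theorem rlIntegral_sub_const_mul {a t α : ℝ} (hα : 0 < α) (h : a < t) {f g : ℝ → ℝ} (r : ℝ)
    (hf : ContinuousOn f (Ioi a)) (hfi : IntegrableOn f (Ioo a t))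
    (hg : ContinuousOn g (Ioi a)) (hgi : IntegrableOn g (Ioo a t)) :
    rlIntegral a α (fun τ => f τ - r * g τ) t = rlIntegral a α f t - r * rlIntegral a α g t := by
  rw [rlIntegral_eq_setIntegral h.le, rlIntegral_eq_setIntegral h.le,
    rlIntegral_eq_setIntegral h.le]
  have h1 : ∀ τ, (t - τ) ^ (α - 1) * (f τ - r * g τ) =
      (t - τ) ^ (α - 1) * f τ - r * ((t - τ) ^ (α - 1) * g τ) := fun τ => by ring
  simp only [h1]
  rw [integral_sub (integrableOn_sub_rpow_mul hα h hf hfi)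
    ((integrableOn_sub_rpow_mul hα h hg hgi).const_mul r), integral_const_mul]
  ring

/-- Factoring the characteristic polynomial reduces the sequential equation to a first-order one,
whose solutions are multiples of the Mittag-Leffler kernel. -/
theorem IsSeqRLSolution.exists_eq_mlKernel {a β a₁ a₀ r ρ : ℝ} (hβ0 : 0 < β) (hβ1 : β < 1)
    {u : ℝ → ℝ} (hu : IsSeqRLSolution a β a₁ a₀ u) (hsum : r + ρ = -a₁) (hprod : r * ρ = a₀) :
    ∃ c, (∀ t, a < t → seqRLDeriv a β 1 u t - ρ * u t = c * mlKernel β r (t - a)) ∧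
      Tendsto (fun t => rlIntegral a (1 - β) (seqRLDeriv a β 1 u) t -
        ρ * rlIntegral a (1 - β) u t) (𝓝[>] a) (𝓝 c) := by
  set y := seqRLDeriv a β 1 u with hy
  obtain ⟨huc, hui, -⟩ := hu.rlDifferentiable
  obtain ⟨hyc, hyi, -⟩ := hu.rlDifferentiable_seq
  have hlin : ∀ t, a < t → rlIntegral a (1 - β) (fun τ => y τ - ρ * u τ) t =
      rlIntegral a (1 - β) y t - ρ * rlIntegral a (1 - β) u t := fun t ht =>
    rlIntegral_sub_const_mul (by linarith) ht ρ hyc (hyi t ht) huc (hui t ht)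
  have hvc : ContinuousOn (fun τ => y τ - ρ * u τ) (Ioi a) := hyc.sub (huc.const_mul ρ)
  have hvi : ∀ t, a < t → IntegrableOn (fun τ => y τ - ρ * u τ) (Ioo a t) := fun t ht =>
    (hyi t ht).sub ((hui t ht).const_mul ρ)
  have hd : ∀ t, a < t → HasDerivAt (rlIntegral a (1 - β) (fun τ => y τ - ρ * u τ))
      (r * (y t - ρ * u t)) t := by
    intro t ht
    have h1 := hu.rlDifferentiable_seq.hasDerivAt hβ1 ht
    have h2 := hu.rlDifferentiable.hasDerivAt hβ1 ht
    have h3 := h1.sub (h2.const_mul ρ)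
    have h4 : seqRLDeriv a β 2 u t + a₁ * y t + a₀ * u t = 0 := hu.equation t ht
    have h5 : rlDeriv a β (seqRLDeriv a β 1 u) t - ρ * rlDeriv a β u t =
        r * (y t - ρ * u t) := by
      have e1 : rlDeriv a β (seqRLDeriv a β 1 u) t = seqRLDeriv a β 2 u t := rfl
      have e2 : rlDeriv a β u t = y t := rfl
      rw [e1, e2]
      linear_combination h4 - y t * hsum + u t * hprod
    rw [h5] at h3
    refine h3.congr_of_eventuallyEq ?_
    filter_upwards [Ioi_mem_nhds ht] with s hs
    exact hlin s hs
  obtain ⟨c, hc, hlim⟩ := exists_rlIntegral_eq_add_primitive hvc hvi hd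
  refine ⟨c, fun t ht => eq_const_mul_mlKernel hβ0 hβ1 hvc hvi hc ht, hlim.congr' ?_⟩
  filter_upwards [self_mem_nhdsWithin] with t ht
  exact hlin t ht

/-- A combination of two Mittag-Leffler moment functions has `t u' / u → -1 - β`, unless its
leading coefficient vanishes. -/
theorem tendsto_mul_deriv_div_of_eq_mlMoment {a β l₁ l₂ d₁ d₂ : ℝ} (hβ0 : 0 < β) (hβ1 : β < 1)
    (hl₁ : 0 < l₁) (hl₂ : 0 < l₂) (hd : d₁ / l₁ ^ 2 + d₂ / l₂ ^ 2 ≠ 0) {u : ℝ → ℝ}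
    (hu : ∀ t, a < t → u t = d₁ * mlMoment β l₁ 0 (t - a) + d₂ * mlMoment β l₂ 0 (t - a)) :
    (∀ t, a < t → DifferentiableAt ℝ u t) ∧ (∀ᶠ t in atTop, u t ≠ 0) ∧
      Tendsto (fun t => t * deriv u t / u t) atTop (𝓝 (-1 - β)) := by
  have hderiv : ∀ t, a < t → HasDerivAt u
      (-(d₁ * mlMoment β l₁ 1 (t - a) + d₂ * mlMoment β l₂ 1 (t - a))) t := by
    intro t ht
    have hs : 0 < t - a := sub_pos.2 ht
    have h1 := ((hasDerivAt_mlMoment hβ0 hβ1 hl₁ le_rfl hs).comp_sub_const t a).const_mul d₁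
    have h2 := ((hasDerivAt_mlMoment hβ0 hβ1 hl₂ le_rfl hs).comp_sub_const t a).const_mul d₂
    have h3 := h1.add h2
    rw [zero_add, mul_neg, mul_neg, ← neg_add] at h3
    refine h3.congr_of_eventuallyEq ?_
    filter_upwards [Ioi_mem_nhds ht] with s hs
    exact hu s hs
  have hsh : Tendsto (fun t : ℝ => t - a) atTop atTop := tendsto_atTop_add_const_right _ (-a)
    tendsto_id
  set A : ℝ := Real.sin (Real.pi * β) / Real.pi with hA
  have hA0 : 0 < A := div_pos (sin_pi_mul_pos hβ0 hβ1) Real.pi_pos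
  set B : ℝ := d₁ / l₁ ^ 2 + d₂ / l₂ ^ 2 with hB
  have hΓ : 0 < Real.Gamma (β + 1) := Real.Gamma_pos_of_pos (by linarith)
  have hlim : ∀ γ : ℝ, 0 ≤ γ → Tendsto (fun t => (t - a) ^ (β + γ + 1) *
      (d₁ * mlMoment β l₁ γ (t - a) + d₂ * mlMoment β l₂ γ (t - a))) atTop
      (𝓝 (A * B * Real.Gamma (β + γ + 1))) := by
    intro γ hγ
    have h1 := ((tendsto_rpow_mul_mlMoment hβ0 hβ1 hl₁ hγ).comp hsh).const_mul d₁
    have h2 := ((tendsto_rpow_mul_mlMoment hβ0 hβ1 hl₂ hγ).comp hsh).const_mul d₂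
    convert! h1.add h2 using 2
    · simp only [Function.comp]
      ring
    · rw [hB, ← hA]
      ring
  have h0 := hlim 0 le_rfl
  have h1 := hlim 1 zero_le_one
  rw [add_zero] at h0
  rw [Real.Gamma_add_one (s := β + 1) (by positivity)] at h1
  have hne : A * B * Real.Gamma (β + 1) ≠ 0 := mul_ne_zero (mul_ne_zero hA0.ne' hd) hΓ.ne'
  refine ⟨fun t ht => (hderiv t ht).differentiableAt, ?_, ?_⟩
  · filter_upwards [h0.eventually_ne hne, eventually_gt_atTop a] with t ht hat h
    rw [← hu t hat, h, mul_zero] at ht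
    exact ht rfl
  -- The asymptotics are in powers of `t - a`; the factor `t / (t - a) = 1 + a / (t - a)` converts
  -- to `t`.
  · have hts : Tendsto (fun t : ℝ => 1 + a / (t - a)) atTop (𝓝 (1 + 0)) :=
      tendsto_const_nhds.add (tendsto_const_nhds.div_atTop hsh)
    have h2 := (hts.mul (h1.div h0 hne)).neg
    have hval : -((1 + 0) * (A * B * ((β + 1) * Real.Gamma (β + 1)) /
        (A * B * Real.Gamma (β + 1)))) = -1 - β := by
      have hB0 : B ≠ 0 := hd
      field_simp
      ring
    rw [hval] at h2
    refine h2.congr' ?_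
    filter_upwards [h0.eventually_ne hne, eventually_gt_atTop a] with t ht hat
    have hs : 0 < t - a := sub_pos.2 hat
    rw [(hderiv t hat).deriv]
    simp only [Pi.div_apply]
    rw [← hu t hat] at ht ⊢
    have hp := Real.rpow_pos_of_pos hs (β + 1)
    have hu0 : u t ≠ 0 := right_ne_zero_of_mul ht
    rw [Real.rpow_add_one (x := t - a) hs.ne' (β + 1), one_add_div hs.ne', sub_add_cancel]
    field_simp

theorem theorem1 (β : ℝ) (hβ0 : 0 < β) (hβ1 : β < 1)
    (a₀ a₁ r₁ r₂ : ℝ)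
    (hr₁ : r₁ ^ 2 + a₁ * r₁ + a₀ = 0) (hr₂ : r₂ ^ 2 + a₁ * r₂ + a₀ = 0)
    (hne : r₁ ≠ r₂) (hr₁neg : r₁ < 0) (hr₂neg : r₂ < 0)
    (a t₀ u₀ u₁ : ℝ) (u : ℝ → ℝ) (hu : IsSeqRLSolution a β a₁ a₀ u)
    (hinit :
      -- initial time to the right of the lower terminal: ordinary values
      (a < t₀ ∧ u t₀ = u₀ ∧ seqRLDeriv a β 1 u t₀ = u₁ ∧
        r₁ ^ 2 * (u₁ - r₁ * u₀) * mittagLeffler β β (r₁ * (t₀ - a) ^ β) ≠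
          r₂ ^ 2 * (u₁ - r₂ * u₀) * mittagLeffler β β (r₂ * (t₀ - a) ^ β)) ∨
      -- initial time equal to the lower terminal: Riemann-Liouville initial values
      (a = t₀ ∧ Tendsto (rlIntegral a (1 - β) u) (𝓝[>] t₀) (𝓝 u₀) ∧
        Tendsto (rlIntegral a (1 - β) (seqRLDeriv a β 1 u)) (𝓝[>] t₀) (𝓝 u₁) ∧
        a₁ * u₁ + (a₁ ^ 2 - a₀) * u₀ ≠ 0)) :
    (∀ t, a < t → DifferentiableAt ℝ u t) ∧
    (∀ᶠ t in atTop, u t ≠ 0) ∧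
    ∃ L : ℝ, Tendsto (fun t => t * deriv u t / u t) atTop (𝓝 L) ∧ β = -1 - L := by
  have hrr : r₁ - r₂ ≠ 0 := sub_ne_zero.2 hne
  have hsum : r₁ + r₂ = -a₁ := mul_left_cancel₀ hrr (by linear_combination hr₁ - hr₂)
  have hprod : r₁ * r₂ = a₀ := by linear_combination r₁ * hsum - hr₁
  obtain ⟨c₁, hc₁, hlim₁⟩ := hu.exists_eq_mlKernel hβ0 hβ1 hsum hprod
  obtain ⟨c₂, hc₂, hlim₂⟩ := hu.exists_eq_mlKernel (r := r₂) (ρ := r₁) hβ0 hβ1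
    (by linarith) (by linarith)
  -- This is the non-vanishing of the leading coefficient. For `t₀ > a` the constants are read off
  -- at `t₀`, with the powers of `t₀ - a` common to both kernels. For `t₀ = a` they are `c₁ = u₁ -
  -- r₂ u₀` and `c₂ = u₁ - r₁ u₀`, and `r₂² c₁ - r₁² c₂` is `r₁ - r₂` times the non-degenerate
  -- quantity.
  have hcc : r₂ ^ 2 * c₁ ≠ r₁ ^ 2 * c₂ := by
    intro h
    rcases hinit with ⟨hat, rfl, rfl, hnd⟩ | ⟨rfl, hu₀, hu₁, hnd⟩
    · refine hnd ?_
      rw [hc₁ t₀ hat, hc₂ t₀ hat, mlKernel, mlKernel]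
      linear_combination (-((t₀ - a) ^ (β - 1) * mittagLeffler β β (r₁ * (t₀ - a) ^ β) *
        mittagLeffler β β (r₂ * (t₀ - a) ^ β))) * h
    · have e₁ := tendsto_nhds_unique hlim₁ (hu₁.sub (hu₀.const_mul r₂))
      have e₂ := tendsto_nhds_unique hlim₂ (hu₁.sub (hu₀.const_mul r₁))
      refine hnd (mul_left_cancel₀ hrr ?_)
      rw [e₁, e₂] at h
      have ha₁ : a₁ = -(r₁ + r₂) := by linarith
      rw [ha₁, ← hprod]
      linear_combination h
  -- Subtracting the two first-order relations eliminates `D^β u` and leaves `(r₁ - r₂) u`.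
  have hform : ∀ t, a < t → u t = c₁ / (r₁ - r₂) * mlMoment β (-r₁) 0 (t - a) +
      -(c₂ / (r₁ - r₂)) * mlMoment β (-r₂) 0 (t - a) := by
    intro t ht
    have hs : 0 < t - a := sub_pos.2 ht
    have h₁ := hc₁ t ht
    have h₂ := hc₂ t ht
    have k₁ := mlKernel_neg_eq_mlMoment hβ0 hβ1 (neg_pos.2 hr₁neg) hs
    have k₂ := mlKernel_neg_eq_mlMoment hβ0 hβ1 (neg_pos.2 hr₂neg) hs
    rw [neg_neg] at k₁ k₂
    rw [← k₁, ← k₂]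
    field_simp
    linear_combination h₁ - h₂
  have hd : c₁ / (r₁ - r₂) / (-r₁) ^ 2 + -(c₂ / (r₁ - r₂)) / (-r₂) ^ 2 ≠ 0 := by
    intro h
    have := hr₁neg.ne
    have := hr₂neg.ne
    rw [neg_sq, neg_sq] at h
    field_simp at h
    exact hcc (by linear_combination h)
  obtain ⟨h1, h2, h3⟩ := tendsto_mul_deriv_div_of_eq_mlMoment hβ0 hβ1 (neg_pos.2 hr₁neg)
    (neg_pos.2 hr₂neg) hd hform
  exact ⟨h1, h2, -1 - β, h3, by ring⟩
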